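/- Let $d\ge 2$ and let $\Omega\subset\mathbb{R}^d$ be a bounded Lipschitz domain (a bounded open set that is, locally near each boundary point and after a rigid motion, the region below the graph of a Lipschitz function), with boundary $\Gamma=\partial\Omega$ and exterior unit normal $\boldsymbol n$. All functions are real-valued. Let $H^1(\Omega)$ be the space of $\varphi\in L^2(\Omega)$ with weak gradient $\nabla\varphi\in L^2(\Omega)^d$, let $H(\mathrm{div},\Omega)$ be the space of $\boldsymbol\sigma\in L^2(\Omega)^d$ with weak divergence $\mathrm{div}\,\boldsymbol\sigma\in L^2(\Omega)$, and let $\varphi\mapsto\varphi|_\Gamma$ be the trace operator $H^1(\Omega)\to L^2(\Gamma)$, i.e. the continuous extension of the restriction to $\Gamma$ of functions smooth up to the boundary. Put $H^{1/2}(\Gamma)=\{\varphi|_\Gamma:\varphi\in H^1(\Omega)\}$ with the quotient norm $\|f\|_{H^{1/2}(\Gamma)}=\inf\{\|\varphi\|_{H^1(\Omega)}:\varphi|_\Gamma=f\}$, let $H^{-1/2}(\Gamma)$ be its dual with duality product $\langle\cdot,\cdot\rangle_\Gamma$, and for $\boldsymbol\sigma\in H(\mathrm{div},\Omega)$ let $\boldsymbol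 n\cdot\boldsymbol\sigma|_\Gamma\in H^{-1/2}(\Gamma)$ be the normal trace, given by $\langle\varphi|_\Gamma,\boldsymbol n\cdot\boldsymbol\sigma|_\Gamma\rangle_\Gamma=\int_\Omega\nabla\varphi\cdot\boldsymbol\sigma\,dx+\int_\Omega\varphi\,\mathrm{div}\,\boldsymbol\sigma\,dx$ for all $\varphi\in H^1(\Omega)$. Let $g\in H^{1/2}(\Gamma)$ and let $u\in H^1(\Omega)$ be the unique solution of $\Delta u=0$ in $\Omega$ (in the sense of distributions) with $u|_\Gamma=g$. Let $v\in H^1(\Omega)$ be any function with $\Delta v=0$ in $\Omega$. Then $$\max_{\substack{\boldsymbol\tau\in L^2(\Omega)^d\\ \mathrm{div}\,\boldsymbol\tau=0}}\Big(2\,\langle g-v|_\Gamma,\boldsymbol n\cdot\boldsymbol\tau|_\Gamma\rangle_\Gamma-\|\boldsymbol\tau\|_{L^2(\Omega)}^2\Big)=\|\nabla(u-v)\|_{L^2(\Omega)}^2=\min_{\substack{w\in H^1(\Omega)\\ w|_\Gamma=g-v|_\Gamma}}\|\nabla w\|_{L^2(\Omega)}^2 .$$ Both extrema are attained; the unique maximiser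 is $\boldsymbol\tau=\nabla(u-v)$ and the unique minimiser is $w=u-v$. -/

import Mathlib

open MeasureTheory
open scoped ContDiff

noncomputable section

namespace FunctionalError

/-- Euclidean space `ℝ^d`. -/
abbrev E (d : ℕ) : Type := EuclideanSpace ℝ (Fin d)

/-- Bounded Lipschitz domain: a bounded open set which, near every boundary point and after a rigid
motion of coordinates, lies strictly below the graph of a Lipschitz function of `d - 1` variables
(the Lipschitz function absorbs the translation).  Connectedness is not required. -/
structure IsBoundedLipschitzDomain {d : ℕ} (Ω : Set (E d)) : Prop where
  isOpen : IsOpen Ω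
  isBounded : Bornology.IsBounded Ω
  locally_subgraph : ∀ x ∈ frontier Ω,
    ∃ (R : E d ≃ₗᵢ[ℝ] WithLp 2 (E (d - 1) × ℝ)) (K : NNReal) (γ : E (d - 1) → ℝ),
      LipschitzWith K γ ∧ ∃ U ∈ nhds x, ∀ y ∈ U, y ∈ Ω ↔ (R y).snd < γ (R y).fst

variable {d : ℕ}

/-- The surface measure on `Γ = ∂Ω`: the `(d-1)`-dimensional Hausdorff measure, normalised to agree
with Lebesgue measure on `(d-1)`-dimensional planes. -/
def surface (Ω : Set (E d)) : Measure (E d) :=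
  (Measure.euclideanHausdorffMeasure (d - 1)).restrict (frontier Ω)

/-- `L²(Ω)`, scalar functions. -/
abbrev L2 (Ω : Set (E d)) : Type := Lp ℝ 2 (volume.restrict Ω)

/-- `L²(Ω)`, vector fields. -/
abbrev L2v (Ω : Set (E d)) : Type := Lp (E d) 2 (volume.restrict Ω)

/-- `L²(Γ)`. -/
abbrev L2Γ (Ω : Set (E d)) : Type := Lp ℝ 2 (surface Ω)

/-- Test functions `φ ∈ C_c^∞(Ω)`. -/
structure IsTest (Ω : Set (E d)) (φ : E d → ℝ) : Prop where
  contDiff : ContDiff ℝ ∞ φ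
  hasCompactSupport : HasCompactSupport φ
  tsupport_subset : tsupport φ ⊆ Ω

/-- `G` is the weak gradient of `u` in `Ω`. -/
def HasWeakGrad (Ω : Set (E d)) (u : L2 Ω) (G : L2v Ω) : Prop :=
  ∀ φ : E d → ℝ, IsTest Ω φ →
    ∫ x in Ω, u x • gradient φ x = -∫ x in Ω, φ x • G x

/-- `f` is the weak divergence of `σ` in `Ω`. -/
def HasWeakDiv (Ω : Set (E d)) (σ : L2v Ω) (f : L2 Ω) : Prop :=
  ∀ φ : E d → ℝ, IsTest Ω φ →
    ∫ x in Ω, inner ℝ (σ x) (gradient φ x) = -∫ x in Ω, f x * φ x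

theorem IsTest.memLp {Ω : Set (E d)} {φ : E d → ℝ} (h : IsTest Ω φ) :
    MemLp φ 2 (volume.restrict Ω) :=
  h.contDiff.continuous.memLp_of_hasCompactSupport h.hasCompactSupport

theorem IsTest.memLp_gradient {Ω : Set (E d)} {φ : E d → ℝ} (h : IsTest Ω φ) :
    MemLp (gradient φ) 2 (volume.restrict Ω) := by
  have hc : Continuous (gradient φ) :=
    (InnerProductSpace.toDual ℝ (E d)).symm.continuous.comp
      (h.contDiff.continuous_fderiv (by simp))
  have hs : HasCompactSupport (gradient φ) :=
    (h.hasCompactSupport.fderiv (𝕜 := ℝ)).comp_left (map_zero _)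
  exact hc.memLp_of_hasCompactSupport hs

theorem integrable_smul_of_memLp {F : Type*} [NormedAddCommGroup F] [NormedSpace ℝ F]
    {μ : Measure (E d)} {f : E d → ℝ} {G : E d → F} (hf : MemLp f 2 μ) (hG : MemLp G 2 μ) :
    Integrable (fun x => f x • G x) μ :=
  memLp_one_iff_integrable.1 (hG.smul hf)

/-- The Sobolev space `H¹(Ω)`.  An element is a function of `L²(Ω)` together with its weak gradient
(which is unique) in `L²(Ω)`, so that `H¹(Ω)` carries its usual Hilbert space norm
`(‖φ‖² + ‖∇φ‖²)^{1/2}`. -/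
def H1 (Ω : Set (E d)) : Submodule ℝ (WithLp 2 (L2 Ω × L2v Ω)) where
  carrier := {w | HasWeakGrad Ω w.fst w.snd}
  zero_mem' := by
    intro φ hφ
    have h1 : ∫ x in Ω, (0 : L2 Ω) x • gradient φ x = 0 := by
      refine integral_eq_zero_of_ae ?_
      filter_upwards [Lp.coeFn_zero ℝ 2 (volume.restrict Ω)] with x hx
      rw [hx]
      simp
    have h2 : ∫ x in Ω, φ x • (0 : L2v Ω) x = 0 := by
      refine integral_eq_zero_of_ae ?_
      filter_upwards [Lp.coeFn_zero (E d) 2 (volume.restrict Ω)] with x hx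
      rw [hx]
      simp
    simp only [WithLp.zero_fst, WithLp.zero_snd, h1, h2, neg_zero]
  add_mem' := by
    intro a b ha hb φ hφ
    have h1 : ∫ x in Ω, (a.fst + b.fst : L2 Ω) x • gradient φ x
        = (∫ x in Ω, a.fst x • gradient φ x) + ∫ x in Ω, b.fst x • gradient φ x := by
      rw [← integral_add (integrable_smul_of_memLp (Lp.memLp _) hφ.memLp_gradient)
        (integrable_smul_of_memLp (Lp.memLp _) hφ.memLp_gradient)]
      refine integral_congr_ae ?_
      filter_upwards [Lp.coeFn_add a.fst b.fst] with x hx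
      rw [hx, Pi.add_apply, add_smul]
    have h2 : ∫ x in Ω, φ x • (a.snd + b.snd : L2v Ω) x
        = (∫ x in Ω, φ x • a.snd x) + ∫ x in Ω, φ x • b.snd x := by
      rw [← integral_add (integrable_smul_of_memLp hφ.memLp (Lp.memLp _))
        (integrable_smul_of_memLp hφ.memLp (Lp.memLp _))]
      refine integral_congr_ae ?_
      filter_upwards [Lp.coeFn_add a.snd b.snd] with x hx
      rw [hx, Pi.add_apply, smul_add]
    simp only [WithLp.add_fst, WithLp.add_snd]
    rw [h1, h2, ha φ hφ, hb φ hφ, neg_add]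
  smul_mem' := by
    intro c a ha φ hφ
    have h1 : ∫ x in Ω, (c • a.fst : L2 Ω) x • gradient φ x
        = c • ∫ x in Ω, a.fst x • gradient φ x := by
      rw [← integral_smul]
      refine integral_congr_ae ?_
      filter_upwards [Lp.coeFn_smul c a.fst] with x hx
      simp [hx, mul_smul]
    have h2 : ∫ x in Ω, φ x • (c • a.snd : L2v Ω) x = c • ∫ x in Ω, φ x • a.snd x := by
      rw [← integral_smul]
      refine integral_congr_ae ?_
      filter_upwards [Lp.coeFn_smul c a.snd] with x hx
      simp [hx, smul_comm c]
    simp only [WithLp.smul_fst, WithLp.smul_snd]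
    rw [h1, h2, ha φ hφ, smul_neg]

/-- The underlying `L²` function of an element of `H¹(Ω)`. -/
def fn {Ω : Set (E d)} (w : H1 Ω) : L2 Ω := w.1.fst

/-- The weak gradient of an element of `H¹(Ω)`. -/
def grad {Ω : Set (E d)} (w : H1 Ω) : L2v Ω := w.1.snd

/-- `w ∈ H¹(Ω)` with `Δ w = div ∇ w = 0` in the sense of distributions in `Ω`. -/
def IsHarmonic {Ω : Set (E d)} (w : H1 Ω) : Prop := HasWeakDiv Ω (grad w) 0

/-- The space `H(div, Ω)` of `L²` vector fields with weak divergence in `L²`. -/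
structure Hdiv (Ω : Set (E d)) where
  /-- the vector field -/
  field : L2v Ω
  /-- its divergence -/
  div : L2 Ω
  hasWeakDiv : HasWeakDiv Ω field div

/-- The smooth part of the graph of the trace operator: restrictions to `Ω` and to `Γ` of the same
smooth function on `ℝ^d`. -/
def smoothTraceGraph (Ω : Set (E d)) : Submodule ℝ (H1 Ω × L2Γ Ω) where
  carrier := {p | ∃ φ : E d → ℝ, ContDiff ℝ ∞ φ ∧
    fn p.1 =ᵐ[volume.restrict Ω] φ ∧ p.2 =ᵐ[surface Ω] φ}
  zero_mem' := ⟨0, contDiff_const, Lp.coeFn_zero _ _ _, Lp.coeFn_zero _ _ _⟩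
  add_mem' := by
    rintro a b ⟨φ, hφ, h1, h2⟩ ⟨ψ, hψ, h3, h4⟩
    exact ⟨φ + ψ, hφ.add hψ, (Lp.coeFn_add _ _).trans (h1.add h3),
      (Lp.coeFn_add _ _).trans (h2.add h4)⟩
  smul_mem' := by
    rintro c a ⟨φ, hφ, h1, h2⟩
    exact ⟨c • φ, contDiff_const.smul hφ, (Lp.coeFn_smul _ _).trans (h1.const_smul c),
      (Lp.coeFn_smul _ _).trans (h2.const_smul c)⟩

/-- The graph of the trace operator `H¹(Ω) → L²(Γ)`, i.e. of the continuous extension of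
`φ ↦ φ|_Γ`: the closure in `H¹(Ω) × L²(Γ)` of the graph on smooth functions. -/
def traceGraph (Ω : Set (E d)) : Submodule ℝ (H1 Ω × L2Γ Ω) :=
  (smoothTraceGraph Ω).topologicalClosure

/-- `f ∈ L²(Γ)` is the trace of `w ∈ H¹(Ω)`. -/
def IsTrace {Ω : Set (E d)} (w : H1 Ω) (f : L2Γ Ω) : Prop := (w, f) ∈ traceGraph Ω

/-- The trace space `H^{1/2}(Γ)`: all `f ∈ L²(Γ)` that are the trace of some `w ∈ H¹(Ω)`. -/
def Hhalf (Ω : Set (E d)) : Submodule ℝ (L2Γ Ω) :=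
  (traceGraph Ω).map (LinearMap.snd ℝ (H1 Ω) (L2Γ Ω))

/-- The trace operator `w ↦ w|_Γ` from `H¹(Ω)` onto `H^{1/2}(Γ)`. -/
def trace {Ω : Set (E d)} (w : H1 Ω) : Hhalf Ω :=
  Classical.epsilon fun f : Hhalf Ω => IsTrace w (f : L2Γ Ω)

/-- The dual space `H^{-1/2}(Γ)` of `H^{1/2}(Γ)`: linear functionals `ℓ` that are bounded for the
quotient norm `‖f‖ = inf {‖w‖_{H¹(Ω)} : w|_Γ = f}`.  The duality product `⟨f, ℓ⟩` is `ℓ f`. -/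
def HmHalf (Ω : Set (E d)) : Submodule ℝ (Module.Dual ℝ (Hhalf Ω)) where
  carrier := {ℓ | ∃ C : ℝ, ∀ (w : H1 Ω) (f : Hhalf Ω), IsTrace w (f : L2Γ Ω) → |ℓ f| ≤ C * ‖w‖}
  zero_mem' := ⟨0, fun w f _ => by simp⟩
  add_mem' := by
    rintro a b ⟨C, hC⟩ ⟨D, hD⟩
    refine ⟨C + D, fun w f h => ?_⟩
    calc |(a + b) f| ≤ |a f| + |b f| := abs_add_le _ _
      _ ≤ (C + D) * ‖w‖ := by linarith [hC w f h, hD w f h]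
  smul_mem' := by
    rintro c a ⟨C, hC⟩
    refine ⟨|c| * C, fun w f h => ?_⟩
    have := mul_le_mul_of_nonneg_left (hC w f h) (abs_nonneg c)
    simpa [abs_mul, mul_assoc] using this

/-- The duality product on `H^{1/2}(Γ) × H^{-1/2}(Γ)`. -/
def dualPairing {Ω : Set (E d)} (f : Hhalf Ω) (ℓ : HmHalf Ω) : ℝ := (ℓ : Module.Dual ℝ (Hhalf Ω)) f

/-- The normal trace `n · σ|_Γ ∈ H^{-1/2}(Γ)` of `σ ∈ H(div, Ω)`: the functional given by Green's
formula `⟨φ|_Γ, n · σ|_Γ⟩ = (∇φ, σ)_{L²(Ω)} + (φ, div σ)_{L²(Ω)}` for all `φ ∈ H¹(Ω)`. -/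
def normalTrace {Ω : Set (E d)} (σ : Hdiv Ω) : HmHalf Ω :=
  Classical.epsilon fun ℓ : HmHalf Ω => ∀ (φ : H1 Ω) (f : Hhalf Ω), IsTrace φ (f : L2Γ Ω) →
    dualPairing f ℓ = inner ℝ (grad φ) σ.field + inner ℝ (fn φ) σ.div

/-- The minorant `2 ⟨g - γ, n · τ|_Γ⟩ - ‖τ‖²`, to be used with `γ = v|_Γ`. -/
def minorant {Ω : Set (E d)} (τ : Hdiv Ω) (γ g : Hhalf Ω) : ℝ :=
  2 * dualPairing (g - γ) (normalTrace τ) - ‖τ.field‖ ^ 2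

/-- The majorant `‖σ‖²`, to be used with `σ = ∇w`. -/
def majorant {Ω : Set (E d)} (σ : L2v Ω) : ℝ := ‖σ‖ ^ 2

end FunctionalError

end

/-!
If `div τ = 0`, then Green's formula turns the pairing of `g - v|_Γ = (u - v)|_Γ` with `n · τ|_Γ`
into `(∇(u - v), τ)`, and completing the square gives the maximum.  If `w` has the same trace as
the harmonic function `u - v`, then the gradient of `w - (u - v)` is orthogonal to `∇(u - v)`, and
Pythagoras gives the minimum.

Both facts rest on Green's formula without boundary term, for `w ∈ H¹(Ω)` and `σ ∈ H(div, Ω)` one of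
which keeps its weak derivative when extended by zero to `ℝ^d`.  Localised near a point of the
closure, a Lipschitz domain can be translated into itself; shifting one factor by such translations
and mollifying reduces the formula to test functions.  If the zero extension of `∇w` has divergence
`w`, the formula gives `‖w‖_{H¹}² = 0`, so smooth functions are dense in `H¹(Ω)`.  If `w` has trace
zero, its zero extension has a weak gradient, because `|∫_Ω ∇F| ≤ C ∫_Γ |F|` for smooth `F`.  The
same integration below Lipschitz graphs bounds `∫_Γ F` for `F ≥ 0`, hence the trace operator.
-/

noncomputable section

namespace FunctionalError

open ContinuousLinearMap Set Filter Topology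
open scoped Convolution Pointwise

section Gradient

variable {F : Type*} [NormedAddCommGroup F] [InnerProductSpace ℝ F] [CompleteSpace F] {φ ψ : F → ℝ}

theorem continuous_gradient (hφ : ContDiff ℝ 1 φ) : Continuous (gradient φ) :=
  (InnerProductSpace.toDual ℝ F).symm.continuous.comp (hφ.continuous_fderiv one_ne_zero)

theorem hasCompactSupport_gradient (hφ : HasCompactSupport φ) : HasCompactSupport (gradient φ) :=
  (hφ.fderiv (𝕜 := ℝ)).comp_left (map_zero _)

theorem gradient_fun_mul {x : F} (hφ : DifferentiableAt ℝ φ x) (hψ : DifferentiableAt ℝ ψ x) :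
    gradient (fun y => φ y * ψ y) x = φ x • gradient ψ x + ψ x • gradient φ x := by
  simp only [gradient, fderiv_fun_mul hφ hψ, map_add, map_smulₛₗ, starRingEnd_apply, star_trivial]

theorem gradient_const_sub (φ : F → ℝ) (x t : F) :
    gradient (fun y => φ (x - y)) t = -gradient φ (x - t) := by
  have hneg : fderiv ℝ (fun y => φ (-y)) (t - x) = -fderiv ℝ φ (x - t) := by
    simpa only [neg_one_smul, neg_sub] using fderiv_comp_smul (𝕜 := ℝ) (f := φ) (x := t - x) (-1)
  have hsub := fderiv_comp_sub (𝕜 := ℝ) (f := fun y => φ (-y)) (x := t) x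
  simp only [neg_sub] at hsub
  rw [gradient, hsub, hneg, map_neg, gradient]

end Gradient

section Convolution

variable {X V : Type*} [NormedAddCommGroup X] [InnerProductSpace ℝ X] [FiniteDimensional ℝ X]
  [MeasurableSpace X] [BorelSpace X] [NormedAddCommGroup V] [InnerProductSpace ℝ V]

theorem integrable_inner_of_memLp {α : Type*} [MeasurableSpace α] {μ : Measure α} {f g : α → V}
    (hf : MemLp f 2 μ) (hg : MemLp g 2 μ) : Integrable (fun x => inner ℝ (f x) (g x)) μ :=
  memLp_one_iff_integrable.1 <| MemLp.of_bilin (fun v w => inner ℝ v w) 1 hf hg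
    (hf.1.inner hg.1) (.of_forall fun x => by
      simpa only [one_mul] using nnnorm_inner_le_nnnorm (𝕜 := ℝ) (f x) (g x))

theorem continuous_integral_inner_comp_sub {f g : X → V} (hf : MemLp f 2 volume)
    (hg : MemLp g 2 volume) : Continuous fun z => ∫ x, inner ℝ (g x) (f (x - z)) := by
  let shift : C(X, C(X, X)) := ContinuousMap.curry ⟨fun p => p.2 - p.1, by fun_prop⟩
  have hshift (z : X) : MeasurePreserving (shift z) volume volume :=
    measurePreserving_sub_right _ z
  suffices (fun z => ∫ x, inner ℝ (g x) (f (x - z))) = fun z =>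
      inner ℝ (hg.toLp g) (Lp.compMeasurePreserving (shift z) (hshift z) (hf.toLp f)) by
    rw [this]
    exact continuous_const.inner <|
      continuous_const.compMeasurePreservingLp shift.continuous hshift (by simp)
  ext z
  rw [L2.inner_def]
  refine integral_congr_ae ?_
  filter_upwards [hg.coeFn_toLp, Lp.coeFn_compMeasurePreserving (hf.toLp f) (hshift z),
    (hshift z).quasiMeasurePreserving.ae hf.coeFn_toLp] with x hgx hcomp hfx
  rw [hgx, hcomp, Function.comp_apply, hfx]
  rfl

theorem integrable_smul_inner_comp_sub {f g : X → V} (hf : MemLp f 2 volume)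
    (hg : MemLp g 2 volume) {ρ : X → ℝ} (hρ : Integrable ρ) :
    Integrable (fun p : X × X => ρ p.2 • inner ℝ (g p.1) (f (p.1 - p.2)))
      (volume.prod volume) := by
  have hf2 : Integrable fun p : X × X => ‖ρ p.2‖ * ‖f (p.1 - p.2)‖ ^ 2 :=
    hρ.norm.convolution_integrand (ContinuousLinearMap.mul ℝ ℝ)
      (hf.integrable_norm_pow (p := 2) two_ne_zero)
  have hg2 : Integrable fun p : X × X => ‖g p.1‖ ^ 2 * ‖ρ p.2‖ :=
    (hg.integrable_norm_pow (p := 2) two_ne_zero).mul_prod hρ.norm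
  refine (hf2.add hg2).mono' (hρ.1.comp_snd.smul (hg.1.comp_fst.inner
    (hf.1.comp_quasiMeasurePreserving (quasiMeasurePreserving_sub_of_right_invariant _ _))))
    (.of_forall fun ⟨x, z⟩ => ?_)
  have hinner : ‖(inner ℝ (g x) (f (x - z)) : ℝ)‖ ≤ ‖f (x - z)‖ ^ 2 + ‖g x‖ ^ 2 :=
    (norm_inner_le_norm _ _).trans <| by
      nlinarith [sq_nonneg (‖f (x - z)‖ - ‖g x‖), sq_nonneg (‖f (x - z)‖ + ‖g x‖)]
  calc ‖ρ z • (inner ℝ (g x) (f (x - z)) : ℝ)‖ = ‖ρ z‖ * ‖(inner ℝ (g x) (f (x - z)) : ℝ)‖ :=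
        norm_smul _ _
    _ ≤ ‖ρ z‖ * (‖f (x - z)‖ ^ 2 + ‖g x‖ ^ 2) := by gcongr
    _ = ‖ρ z‖ * ‖f (x - z)‖ ^ 2 + ‖g x‖ ^ 2 * ‖ρ z‖ := by ring

theorem integral_inner_convolution [CompleteSpace V] {f g : X → V} (hf : MemLp f 2 volume)
    (hg : MemLp g 2 volume) {ρ : X → ℝ} (hρ : Continuous ρ) (hρc : HasCompactSupport ρ) :
    ∫ x, inner ℝ (g x) ((ρ ⋆[lsmul ℝ ℝ, volume] f) x)
      = ∫ z, ρ z • ∫ x, inner ℝ (g x) (f (x - z)) := by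
  have hconv (x : X) : Integrable fun z => ρ z • f (x - z) :=
    hρc.convolutionExists_left (lsmul ℝ ℝ) hρ (hf.locallyIntegrable one_le_two) x
  calc ∫ x, inner ℝ (g x) ((ρ ⋆[lsmul ℝ ℝ, volume] f) x)
      = ∫ x, ∫ z, ρ z • inner ℝ (g x) (f (x - z)) := by
        simp only [convolution_lsmul, ← integral_inner (hconv _), inner_smul_right, smul_eq_mul]
    _ = ∫ z, ∫ x, ρ z • inner ℝ (g x) (f (x - z)) :=
        integral_integral_swap
          (integrable_smul_inner_comp_sub hf hg (hρ.integrable_of_hasCompactSupport hρc))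
    _ = ∫ z, ρ z • ∫ x, inner ℝ (g x) (f (x - z)) := by simp only [integral_smul]

end Convolution

section WeakDerivatives

variable {d : ℕ} {O O' : Set (E d)} {w f η φ ρ : E d → ℝ} {G σ : E d → E d}

/-- The vector field `G` is a weak gradient on `O` of the function `w`. Unlike in `HasWeakGrad`,
both are defined on the whole space, so that they may be multiplied by cutoff functions, translated
and mollified. -/
def IsWeakGradientOn (O : Set (E d)) (w : E d → ℝ) (G : E d → E d) : Prop :=
  ∀ φ : E d → ℝ, IsTest O φ → ∫ x, w x • gradient φ x = -∫ x, φ x • G x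

/-- The function `f` is a weak divergence on `O` of the vector field `σ`, both being defined on the
whole space as in `IsWeakGradientOn`. -/
def IsWeakDivergenceOn (O : Set (E d)) (σ : E d → E d) (f : E d → ℝ) : Prop :=
  ∀ φ : E d → ℝ, IsTest O φ → ∫ x, inner ℝ (σ x) (gradient φ x) = -∫ x, f x * φ x

theorem IsTest.mono (hφ : IsTest O φ) (h : O ⊆ O') : IsTest O' φ :=
  ⟨hφ.contDiff, hφ.hasCompactSupport, hφ.tsupport_subset.trans h⟩

theorem IsTest.mul (hη : IsTest O η) (hφ : ContDiff ℝ ∞ φ) : IsTest O fun x => η x * φ x where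
  contDiff := hη.contDiff.mul hφ
  hasCompactSupport := hη.hasCompactSupport.mul_right
  tsupport_subset := tsupport_mul_subset_left.trans hη.tsupport_subset

theorem IsTest.differentiableAt (hφ : IsTest O φ) (x : E d) : DifferentiableAt ℝ φ x :=
  hφ.contDiff.differentiable (by simp) x

theorem IsTest.const_sub (hρ : IsTest univ ρ) {x : E d} (hx : ∀ t ∈ tsupport ρ, x - t ∈ O) :
    IsTest O (fun t => ρ (x - t)) where
  contDiff := hρ.contDiff.comp (contDiff_const.sub contDiff_id)
  hasCompactSupport := hρ.hasCompactSupport.comp_homeomorph (Homeomorph.subLeft x)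
  tsupport_subset t ht := by
    have := hx (x - t) (tsupport_comp_subset_preimage ρ (Homeomorph.subLeft x).continuous ht)
    rwa [sub_sub_cancel] at this

theorem IsTest.convolution (hρ : IsTest O ρ) (hw : LocallyIntegrable w) (hwc : HasCompactSupport w)
    (hO' : ∀ z ∈ tsupport ρ, ∀ y ∈ tsupport w, y + z ∈ O') :
    IsTest O' (ρ ⋆[lsmul ℝ ℝ, volume] w) where
  contDiff := hρ.hasCompactSupport.contDiff_convolution_left _ hρ.contDiff hw
  hasCompactSupport := hρ.hasCompactSupport.convolution _ hwc
  tsupport_subset y hy := by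
    have hsub : tsupport (ρ ⋆[lsmul ℝ ℝ, volume] w) ⊆ tsupport ρ + tsupport w :=
      closure_minimal ((support_convolution_subset _).trans
        (add_subset_add subset_closure subset_closure))
        (hρ.hasCompactSupport.isCompact.add hwc.isCompact).isClosed
    obtain ⟨z, hz, x, hx, hzx⟩ := mem_add.1 (hsub hy)
    rw [← hzx, add_comm]
    exact hO' z hz x hx

theorem IsWeakGradientOn.gradient_convolution (h : IsWeakGradientOn O w G)
    (hw : LocallyIntegrable w) (hρ : IsTest univ ρ) {x : E d}
    (hx : ∀ t ∈ tsupport ρ, x - t ∈ O) :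
    gradient (ρ ⋆[lsmul ℝ ℝ, volume] w) x = (ρ ⋆[lsmul ℝ ℝ, volume] G) x := by
  have hρ1 : ContDiff ℝ 1 ρ := hρ.contDiff.of_le (by simp)
  have hfderiv : Integrable fun t =>
      (lsmul ℝ ℝ).precompL (E d) (fderiv ℝ ρ (x - t)) (w t) :=
    ((hρ.hasCompactSupport.fderiv (𝕜 := ℝ)).convolutionExists_left _
      (hρ1.continuous_fderiv one_ne_zero) hw x).integrable_swap
  have hgrad : Integrable fun t => w t • gradient ρ (x - t) :=
    (hasCompactSupport_gradient hρ.hasCompactSupport).convolutionExists_right (lsmul ℝ ℝ) hw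
      (continuous_gradient hρ1) x
  have hG : ∫ t, w t • gradient ρ (x - t) = (ρ ⋆[lsmul ℝ ℝ, volume] G) x := by
    have := h _ (hρ.const_sub hx)
    simpa only [gradient_const_sub, smul_neg, integral_neg, neg_inj,
      ← convolution_lsmul_swap] using this
  refine ext_inner_right ℝ fun v => ?_
  rw [← hG, inner_gradient_left,
    (hρ.hasCompactSupport.hasFDerivAt_convolution_left (lsmul ℝ ℝ) hρ1 hw x).fderiv,
    convolution_eq_swap, ContinuousLinearMap.integral_apply hfderiv, real_inner_comm,
    ← integral_inner hgrad]
  congr 1 with t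
  simp [inner_smul_right, inner_gradient_right, mul_comm]

theorem IsWeakGradientOn.smul (h : IsWeakGradientOn O w G) (hw : MemLp w 2 volume)
    (hG : MemLp G 2 volume) (hη : ContDiff ℝ ∞ η) (hηc : HasCompactSupport η)
    (hO : ∀ x ∈ O', x ∈ tsupport η → x ∈ O) :
    IsWeakGradientOn O' (fun x => η x * w x) fun x => η x • G x + w x • gradient η x := by
  intro φ hφ
  have hηφ : IsTest O (fun x => η x * φ x) :=
    ⟨hη.mul hφ.contDiff, hφ.hasCompactSupport.mul_left, fun x hx =>
      hO x (hφ.tsupport_subset (tsupport_mul_subset_right hx)) (tsupport_mul_subset_left hx)⟩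
  have hφ2 : MemLp φ 2 volume :=
    hφ.contDiff.continuous.memLp_of_hasCompactSupport hφ.hasCompactSupport
  have hη1 : ContDiff ℝ 1 η := hη.of_le (by simp)
  have hηG : Integrable fun x => φ x • η x • G x :=
    integrable_smul_of_memLp hφ2 (hG.smul (hη.continuous.memLp_top_of_hasCompactSupport hηc _))
  have hwη : Integrable fun x => φ x • w x • gradient η x :=
    integrable_smul_of_memLp hφ2 (((continuous_gradient hη1).memLp_top_of_hasCompactSupport
      (hasCompactSupport_gradient hηc) _).smul hw)
  have hwηφ : Integrable fun x => w x • gradient (fun y => η y * φ y) x :=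
    integrable_smul_of_memLp hw ((continuous_gradient
      (hηφ.contDiff.of_le (by simp))).memLp_of_hasCompactSupport
        (hasCompactSupport_gradient hηφ.hasCompactSupport))
  calc ∫ x, (η x * w x) • gradient φ x
      = ∫ x, (w x • gradient (fun y => η y * φ y) x - φ x • w x • gradient η x) := by
        congr 1 with x : 1
        rw [gradient_fun_mul (hη1.differentiable one_ne_zero x) (hφ.differentiableAt x)]
        module
    _ = -∫ x, φ x • (η x • G x + w x • gradient η x) := by
        rw [integral_sub hwηφ hwη, h _ hηφ]
        simp only [smul_add]
        rw [integral_add hηG hwη, neg_add, sub_eq_add_neg]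
        congr 3 with x : 1
        module

theorem IsWeakGradientOn.integral_smul_green_shift_eq_zero {O₁ O₂ Z : Set (E d)}
    (hwG : IsWeakGradientOn O₁ w G) (hσf : IsWeakDivergenceOn O₂ σ f) (hw : MemLp w 2 volume)
    (hG : MemLp G 2 volume) (hσ : MemLp σ 2 volume) (hf : MemLp f 2 volume)
    (hwc : HasCompactSupport w) (hσZ : ∀ z ∈ Z, ∀ x, σ x ≠ 0 → x - z ∈ O₁)
    (hwZ : ∀ z ∈ Z, ∀ y ∈ tsupport w, y + z ∈ O₂) (hρ : IsTest Z ρ) :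
    ∫ z, ρ z • ((∫ x, inner ℝ (σ x) (G (x - z))) + ∫ x, inner ℝ (f x) (w (x - z))) = 0 := by
  have hρ0 := hρ.contDiff.continuous
  have hρc := hρ.hasCompactSupport
  have hwloc : LocallyIntegrable w := hw.locallyIntegrable one_le_two
  have hρw : IsTest O₂ (ρ ⋆[lsmul ℝ ℝ, volume] w) :=
    hρ.convolution hwloc hwc fun z hz y hy => hwZ z (hρ.tsupport_subset hz) y hy
  have hgrad (x : E d) : inner ℝ (σ x) ((ρ ⋆[lsmul ℝ ℝ, volume] G) x)
      = inner ℝ (σ x) (gradient (ρ ⋆[lsmul ℝ ℝ, volume] w) x) := by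
    by_cases hx : σ x = 0
    · simp only [hx, inner_zero_left]
    · rw [hwG.gradient_convolution hwloc (hρ.mono (subset_univ _))
        fun t ht => hσZ t (hρ.tsupport_subset ht) x hx]
  have hmul (x : E d) : inner ℝ (f x) ((ρ ⋆[lsmul ℝ ℝ, volume] w) x)
      = f x * (ρ ⋆[lsmul ℝ ℝ, volume] w) x := mul_comm _ _
  have hρσ : Integrable fun z => ρ z • ∫ x, inner ℝ (σ x) (G (x - z)) :=
    (hρ0.smul (continuous_integral_inner_comp_sub hG hσ)).integrable_of_hasCompactSupport
      hρc.smul_right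
  have hρf : Integrable fun z => ρ z • ∫ x, inner ℝ (f x) (w (x - z)) :=
    (hρ0.smul (continuous_integral_inner_comp_sub hw hf)).integrable_of_hasCompactSupport
      hρc.smul_right
  simp only [smul_add]
  rw [integral_add hρσ hρf, ← integral_inner_convolution hG hσ hρ0 hρc,
    ← integral_inner_convolution hw hf hρ0 hρc]
  simp only [hgrad, hmul, hσf _ hρw, neg_add_cancel]

/-- Green's formula for a field and a function that do not overlap after a small translation: the
left-hand side, with `w` and `G` translated by `z`, is continuous in `z`, and it vanishes for
`z ∈ Z` because mollifying the translates of `w` gives test functions on `O₂`. -/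
theorem IsWeakGradientOn.green_of_shifts {O₁ O₂ Z : Set (E d)} (hwG : IsWeakGradientOn O₁ w G)
    (hσf : IsWeakDivergenceOn O₂ σ f) (hw : MemLp w 2 volume) (hG : MemLp G 2 volume)
    (hσ : MemLp σ 2 volume) (hf : MemLp f 2 volume) (hwc : HasCompactSupport w) (hZ : IsOpen Z)
    (h0 : 0 ∈ closure Z) (hσZ : ∀ z ∈ Z, ∀ x, σ x ≠ 0 → x - z ∈ O₁)
    (hwZ : ∀ z ∈ Z, ∀ y ∈ tsupport w, y + z ∈ O₂) :
    (∫ x, inner ℝ (G x) (σ x)) + ∫ x, w x * f x = 0 := by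
  set Q : E d → ℝ := fun z =>
    (∫ x, inner ℝ (σ x) (G (x - z))) + ∫ x, inner ℝ (f x) (w (x - z)) with hQ
  have hQc : Continuous Q :=
    (continuous_integral_inner_comp_sub hG hσ).add (continuous_integral_inner_comp_sub hw hf)
  have hQZ : EqOn Q 0 Z := by
    have hae := hZ.ae_eq_zero_of_integral_contDiff_smul_eq_zero
      (hQc.locallyIntegrable.locallyIntegrableOn Z) fun ρ hρ hρc hρZ =>
        hwG.integral_smul_green_shift_eq_zero hσf hw hG hσ hf hwc hσZ hwZ ⟨hρ, hρc, hρZ⟩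
    exact Measure.eqOn_open_of_ae_eq ((ae_restrict_iff' hZ.measurableSet).2 hae) hZ
      hQc.continuousOn continuousOn_const
  have hQ0 : Q 0 = 0 := hQZ.closure hQc continuous_zero h0
  have hmul (x : E d) : inner ℝ (f x) (w x) = w x * f x := rfl
  simpa only [hQ, sub_zero, hmul, real_inner_comm] using hQ0

end WeakDerivatives

section Green

variable {d : ℕ} {Ω : Set (E d)} {w f : E d → ℝ} {G σ : E d → E d}

open scoped Manifold in
theorem exists_smooth_partition {K : Set (E d)} (hK : IsCompact K) (U : E d → Set (E d))
    (hU : ∀ x ∈ K, U x ∈ 𝓝 x) :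
    ∃ (ι : Type) (_ : Fintype ι) (c : ι → E d) (η : ι → E d → ℝ), (∀ i, c i ∈ K) ∧
      (∀ i, IsTest (U (c i)) (η i)) ∧ (∀ i y, 0 ≤ η i y) ∧ ∀ y ∈ K, ∑ i, η i y = 1 := by
  obtain ⟨t, htK, hKt⟩ := hK.elim_nhds_subcover (fun x => interior (U x) ∩ Metric.ball x 1)
    fun x hx => inter_mem (interior_mem_nhds.2 (hU x hx)) (Metric.ball_mem_nhds x one_pos)
  obtain ⟨η, hη⟩ := SmoothPartitionOfUnity.exists_isSubordinate 𝓘(ℝ, E d) hK.isClosed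
    (fun i : t => interior (U i) ∩ Metric.ball (i : E d) 1)
    (fun i => isOpen_interior.inter Metric.isOpen_ball)
    (hKt.trans fun y hy => by simpa only [mem_iUnion, Subtype.exists] using hy)
  refine ⟨t, inferInstance, (↑), fun i => η i, fun i => htK i i.2, fun i => ⟨?_, ?_, ?_⟩,
    fun i => η.nonneg i, fun y hy => ?_⟩
  · exact (η i).contMDiff.contDiff
  · exact Metric.isCompact_of_isClosed_isBounded (isClosed_tsupport _)
      (Metric.isBounded_ball.subset ((hη i).trans inter_subset_right))
  · exact (hη i).trans (inter_subset_left.trans interior_subset)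
  · simpa only [finsum_eq_sum_of_fintype] using η.sum_eq_one hy

theorem sum_gradient_eq_zero {ι : Type*} [Fintype ι] {η : ι → E d → ℝ}
    (hη : ∀ i, Differentiable ℝ (η i)) {x : E d} (hsum : ∀ᶠ y in 𝓝 x, ∑ i, η i y = 1) :
    ∑ i, gradient (η i) x = 0 := by
  have hfderiv : ∑ i, fderiv ℝ (η i) x = 0 := by
    rw [← fderiv_fun_sum fun i _ => hη i x, EventuallyEq.fderiv_eq hsum, fderiv_fun_const,
      Pi.zero_apply]
  simp only [gradient, ← map_sum, hfderiv, map_zero]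

theorem memLp_gradient_cutoff (hw : MemLp w 2 volume) (hG : MemLp G 2 volume) {η : E d → ℝ}
    (hη : IsTest univ η) : MemLp (fun x => η x • G x + w x • gradient η x) 2 volume :=
  (hG.smul (hη.contDiff.continuous.memLp_top_of_hasCompactSupport hη.hasCompactSupport _)).add
    (((continuous_gradient (hη.contDiff.of_le (by simp))).memLp_top_of_hasCompactSupport
      (hasCompactSupport_gradient hη.hasCompactSupport) _).smul hw)

theorem memLp_cutoff (hw : MemLp w 2 volume) {η : E d → ℝ} (hη : IsTest univ η) :
    MemLp (fun x => η x * w x) 2 volume :=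
  hw.smul (hη.contDiff.continuous.memLp_top_of_hasCompactSupport hη.hasCompactSupport _)

theorem green_of_partition {ι : Type*} [Fintype ι] {η : ι → E d → ℝ} (hΩ : IsOpen Ω)
    (hη : ∀ i, IsTest univ (η i)) (hsum : ∀ y ∈ Ω, ∑ i, η i y = 1) (hw : MemLp w 2 volume)
    (hG : MemLp G 2 volume) (hσ : MemLp σ 2 volume) (hf : MemLp f 2 volume)
    (hout : ∀ x ∉ Ω, w x = 0 ∧ G x = 0 ∨ σ x = 0 ∧ f x = 0)
    (hgreen : ∀ i, (∫ x, inner ℝ (η i x • G x + w x • gradient (η i) x) (σ x))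
      + ∫ x, (η i x * w x) * f x = 0) :
    (∫ x, inner ℝ (G x) (σ x)) + ∫ x, w x * f x = 0 := by
  have hpoint (x : E d) : inner ℝ (G x) (σ x) + w x * f x
      = ∑ i, (inner ℝ (η i x • G x + w x • gradient (η i) x) (σ x) + (η i x * w x) * f x) := by
    by_cases hx : x ∈ Ω
    · have hgrad : ∑ i, gradient (η i) x = 0 :=
        sum_gradient_eq_zero (fun i y => (hη i).differentiableAt y)
          (Filter.mem_of_superset (hΩ.mem_nhds hx) hsum)
      rw [Finset.sum_add_distrib, ← sum_inner, Finset.sum_add_distrib, ← Finset.sum_smul,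
        ← Finset.smul_sum, ← Finset.sum_mul, ← Finset.sum_mul, hsum x hx, hgrad, one_smul,
        smul_zero, add_zero, one_mul]
    · rcases hout x hx with ⟨hwx, hGx⟩ | ⟨hσx, hfx⟩
      · simp [hwx, hGx]
      · simp [hσx, hfx]
  have hint {v : E d → ℝ} {H : E d → E d} (hv : MemLp v 2 volume) (hH : MemLp H 2 volume) :
      (∫ x, inner ℝ (H x) (σ x)) + ∫ x, v x * f x = ∫ x, (inner ℝ (H x) (σ x) + v x * f x) ∧
        Integrable fun x => inner ℝ (H x) (σ x) + v x * f x :=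
    ⟨(integral_add (integrable_inner_of_memLp hH hσ) (hv.integrable_mul hf)).symm,
      (integrable_inner_of_memLp hH hσ).add (hv.integrable_mul hf)⟩
  have hcut (i : ι) := hint (memLp_cutoff hw (hη i)) (memLp_gradient_cutoff hw hG (hη i))
  rw [(hint hw hG).1]
  simp only [hpoint]
  rw [integral_finsetSum _ fun i _ => (hcut i).2]
  exact Finset.sum_eq_zero fun i _ => (hcut i).1.symm.trans (hgreen i)

/-- Near every point of its closure, the set `Ω` is moved into itself by arbitrarily small
translations that form an open set. This is the segment property, thickened to a cone. -/
def HasInwardTranslations (Ω : Set (E d)) : Prop :=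
  ∀ x ∈ closure Ω, ∃ N ∈ 𝓝 x, ∃ Z : Set (E d), IsOpen Z ∧ 0 ∈ closure Z ∧
    ∀ y ∈ closure Ω, ∀ z ∈ Z, y ∈ N ∨ y + z ∈ N → y + z ∈ Ω

theorem HasInwardTranslations.exists_partition (h : HasInwardTranslations Ω)
    (hΩb : Bornology.IsBounded Ω) :
    ∃ (ι : Type) (_ : Fintype ι) (η : ι → E d → ℝ) (Z : ι → Set (E d)),
      (∀ i, IsTest univ (η i)) ∧ (∀ y ∈ closure Ω, ∑ i, η i y = 1) ∧
      (∀ i, IsOpen (Z i)) ∧ (∀ i, 0 ∈ closure (Z i)) ∧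
      ∀ i, ∀ y ∈ closure Ω, ∀ z ∈ Z i, y ∈ tsupport (η i) ∨ y + z ∈ tsupport (η i) → y + z ∈ Ω := by
  choose! N hN Z hZ hZ0 hin using h
  obtain ⟨ι, hι, c, η, hc, hη, -, hsum⟩ := exists_smooth_partition hΩb.isCompact_closure N hN
  exact ⟨ι, hι, η, fun i => Z (c i), fun i => (hη i).mono (subset_univ _), hsum,
    fun i => hZ _ (hc i), fun i => hZ0 _ (hc i), fun i y hy z hz hyz =>
      hin _ (hc i) y hy z hz
        (hyz.imp (fun h => (hη i).tsupport_subset h) fun h => (hη i).tsupport_subset h)⟩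

theorem IsWeakGradientOn.green_of_field_eq_zero (hwG : IsWeakGradientOn Ω w G)
    (hσf : IsWeakDivergenceOn univ σ f) (hΩ : IsOpen Ω) (hΩb : Bornology.IsBounded Ω)
    (hΩt : HasInwardTranslations Ω) (hw : MemLp w 2 volume) (hG : MemLp G 2 volume)
    (hσ : MemLp σ 2 volume) (hf : MemLp f 2 volume) (hσ0 : ∀ x ∉ Ω, σ x = 0)
    (hf0 : ∀ x ∉ Ω, f x = 0) :
    (∫ x, inner ℝ (G x) (σ x)) + ∫ x, w x * f x = 0 := by
  obtain ⟨ι, _, η, Z, hη, hsum, hZ, hZ0, hin⟩ := hΩt.exists_partition hΩb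
  refine green_of_partition hΩ hη (fun y hy => hsum y (subset_closure hy)) hw hG hσ hf
    (fun x hx => .inr ⟨hσ0 x hx, hf0 x hx⟩) fun i => ?_
  have hηw : IsWeakGradientOn (Ω ∪ (tsupport (η i))ᶜ) (fun x => η i x * w x)
      fun x => η i x • G x + w x • gradient (η i) x :=
    hwG.smul hw hG (hη i).contDiff (hη i).hasCompactSupport
      fun x hx hxη => hx.resolve_right (not_not_intro hxη)
  refine hηw.green_of_shifts hσf (memLp_cutoff hw (hη i)) (memLp_gradient_cutoff hw hG (hη i)) hσ hf
    (hη i).hasCompactSupport.mul_right (hZ i).neg (by simpa [← neg_closure] using hZ0 i)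
    (fun z hz x hx => ?_) fun z _ y _ => mem_univ _
  have hxΩ : x ∈ Ω := not_imp_comm.1 (hσ0 x) hx
  rw [sub_eq_add_neg, mem_union, or_iff_not_imp_right, mem_compl_iff, not_not]
  exact fun hxη => hin i x (subset_closure hxΩ) (-z) hz (.inr hxη)

theorem IsWeakGradientOn.green_of_function_eq_zero (hwG : IsWeakGradientOn univ w G)
    (hσf : IsWeakDivergenceOn Ω σ f) (hΩ : IsOpen Ω) (hΩb : Bornology.IsBounded Ω)
    (hΩt : HasInwardTranslations Ω) (hw : MemLp w 2 volume) (hG : MemLp G 2 volume)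
    (hσ : MemLp σ 2 volume) (hf : MemLp f 2 volume) (hw0 : ∀ x ∉ Ω, w x = 0)
    (hG0 : ∀ x ∉ Ω, G x = 0) :
    (∫ x, inner ℝ (G x) (σ x)) + ∫ x, w x * f x = 0 := by
  obtain ⟨ι, _, η, Z, hη, hsum, hZ, hZ0, hin⟩ := hΩt.exists_partition hΩb
  refine green_of_partition hΩ hη (fun y hy => hsum y (subset_closure hy)) hw hG hσ hf
    (fun x hx => .inl ⟨hw0 x hx, hG0 x hx⟩) fun i => ?_
  have hηw := hwG.smul (O' := univ) hw hG (hη i).contDiff (hη i).hasCompactSupport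
    fun x _ _ => mem_univ x
  have hsupp : tsupport (fun x => η i x * w x) ⊆ closure Ω :=
    closure_mono fun x hx => not_imp_comm.1 (hw0 x) (right_ne_zero_of_mul hx)
  exact hηw.green_of_shifts hσf (memLp_cutoff hw (hη i)) (memLp_gradient_cutoff hw hG (hη i)) hσ hf
    (hη i).hasCompactSupport.mul_right (hZ i) (hZ0 i) (fun z _ x _ => mem_univ _)
    fun z hz y hy => hin i y (hsupp hy) z hz (.inl (tsupport_mul_subset_left hy))

end Green

section Charts

variable {d : ℕ}

/-- The height of a point above the graph of `γ` in the coordinates given by `R`. -/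
def height (R : E d ≃ₗᵢ[ℝ] WithLp 2 (E (d - 1) × ℝ)) (γ : E (d - 1) → ℝ) (y : E d) : ℝ :=
  (R y).snd - γ (R y).fst

/-- The unit vector in the direction of increasing height in the coordinates given by `R`. -/
def up (R : E d ≃ₗᵢ[ℝ] WithLp 2 (E (d - 1) × ℝ)) : E d := R.symm (WithLp.toLp 2 (0, 1))

/-- In the ball `B(x, r)`, the set `Ω` is the region below the graph of the `K`-Lipschitz function
`γ` in the coordinates given by `R`. -/
structure IsChart (Ω : Set (E d)) (x : E d) (r : ℝ) (R : E d ≃ₗᵢ[ℝ] WithLp 2 (E (d - 1) × ℝ))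
    (K : NNReal) (γ : E (d - 1) → ℝ) : Prop where
  lipschitz : LipschitzWith K γ
  pos : 0 < r
  mem_iff : ∀ y ∈ Metric.ball x r, y ∈ Ω ↔ height R γ y < 0

variable {Ω : Set (E d)} {x : E d} {r : ℝ} {R : E d ≃ₗᵢ[ℝ] WithLp 2 (E (d - 1) × ℝ)}
  {K : NNReal} {γ : E (d - 1) → ℝ}

theorem IsBoundedLipschitzDomain.exists_isChart (h : IsBoundedLipschitzDomain Ω)
    (hx : x ∈ frontier Ω) : ∃ r R K γ, IsChart Ω x r R K γ := by
  obtain ⟨R, K, γ, hγ, U, hU, hUΩ⟩ := h.locally_subgraph x hx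
  obtain ⟨r, hr, hrU⟩ := Metric.mem_nhds_iff.1 hU
  exact ⟨r, R, K, γ, hγ, hr, fun y hy => by rw [hUΩ y (hrU hy), height, sub_neg]⟩

theorem continuous_height (hγ : Continuous γ) : Continuous (height R γ) := by
  unfold height
  fun_prop

theorem height_add_smul_up (y : E d) (s : ℝ) : height R γ (y + s • up R) = height R γ y + s := by
  simp [height, up, add_sub_right_comm]

theorem height_add_le (hγ : LipschitzWith K γ) (y z : E d) :
    height R γ (y + z) ≤ height R γ y + (R z).snd + K * ‖(R z).fst‖ := by
  have := (abs_le.1 ((Real.dist_eq _ _).symm.trans_le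
    (hγ.dist_le_mul ((R y).fst + (R z).fst) (R y).fst))).1
  rw [dist_eq_norm, add_sub_cancel_left] at this
  simp only [height, map_add, WithLp.add_fst, WithLp.add_snd]
  linarith

theorem IsChart.height_nonpos (h : IsChart Ω x r R K γ) {y : E d} (hy : y ∈ Metric.ball x r)
    (hyΩ : y ∈ closure Ω) : height R γ y ≤ 0 := by
  have hsub : Metric.ball x r ∩ Ω ⊆ {z | height R γ z ≤ 0} :=
    fun z hz => ((h.mem_iff z hz.1).1 hz.2).le
  exact closure_minimal hsub (isClosed_le (continuous_height h.lipschitz.continuous)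
    continuous_const) (Metric.isOpen_ball.inter_closure ⟨hy, hyΩ⟩)

theorem IsChart.mem_frontier_iff (h : IsChart Ω x r R K γ) (hΩ : IsOpen Ω) {y : E d}
    (hy : y ∈ Metric.ball x r) : y ∈ frontier Ω ↔ height R γ y = 0 := by
  rw [hΩ.frontier_eq, Set.mem_sdiff, h.mem_iff y hy, not_lt]
  refine ⟨fun hm => le_antisymm (h.height_nonpos hy hm.1) hm.2, fun h0 => ⟨?_, h0.ge⟩⟩
  have hlim : Tendsto (fun s : ℝ => y + s • up R) (𝓝[<] 0) (𝓝 y) := by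
    have : Continuous fun s : ℝ => y + s • up R := by fun_prop
    simpa only [zero_smul, add_zero] using (this.tendsto 0).mono_left nhdsWithin_le_nhds
  refine mem_closure_of_tendsto hlim ?_
  filter_upwards [hlim (Metric.isOpen_ball.mem_nhds hy), self_mem_nhdsWithin] with s hs hs0
  rw [h.mem_iff _ hs, height_add_smul_up, h0, zero_add]
  exact hs0

theorem zero_mem_closure_ball_inter_cone (hr : 0 < r) :
    0 ∈ closure (Metric.ball 0 r ∩ {z | (R z).snd + K * ‖(R z).fst‖ < 0}) := by
  have hlim : Tendsto (fun s : ℝ => s • up R) (𝓝[<] 0) (𝓝 0) := by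
    have : Continuous fun s : ℝ => s • up R := by fun_prop
    simpa only [zero_smul] using (this.tendsto 0).mono_left nhdsWithin_le_nhds
  refine mem_closure_of_tendsto hlim ?_
  filter_upwards [hlim (Metric.ball_mem_nhds 0 hr), self_mem_nhdsWithin] with s hs hs0
  exact ⟨hs, by simpa [up] using hs0⟩

theorem IsBoundedLipschitzDomain.hasInwardTranslations (h : IsBoundedLipschitzDomain Ω) :
    HasInwardTranslations Ω := by
  intro x hx
  have hball {r : ℝ} {y z : E d} (hz : z ∈ Metric.ball 0 (r / 2))
      (hyz : y ∈ Metric.ball x (r / 2) ∨ y + z ∈ Metric.ball x (r / 2)) :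
      y ∈ Metric.ball x r ∧ y + z ∈ Metric.ball x r := by
    have hdist : dist (y + z) y < r / 2 := by simpa using hz
    have := dist_triangle_left y x (y + z)
    have := dist_triangle (y + z) y x
    simp only [Metric.mem_ball] at hyz ⊢
    rcases hyz with h | h <;> constructor <;> linarith [dist_nonneg (x := y + z) (y := y)]
  by_cases hxΩ : x ∈ Ω
  · obtain ⟨r, hr, hrΩ⟩ := Metric.isOpen_iff.1 h.isOpen x hxΩ
    exact ⟨Metric.ball x (r / 2), Metric.ball_mem_nhds x (half_pos hr), Metric.ball 0 (r / 2),
      Metric.isOpen_ball, subset_closure (Metric.mem_ball_self (half_pos hr)),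
      fun y _ z hz hyz => hrΩ (hball hz hyz).2⟩
  · obtain ⟨r, R, K, γ, hch⟩ := h.exists_isChart (x := x)
      (by rw [h.isOpen.frontier_eq]; exact ⟨hx, hxΩ⟩)
    refine ⟨Metric.ball x (r / 2), Metric.ball_mem_nhds x (half_pos hch.pos),
      Metric.ball 0 (r / 2) ∩ {z | (R z).snd + K * ‖(R z).fst‖ < 0},
      Metric.isOpen_ball.inter (isOpen_lt (by fun_prop) continuous_const),
      zero_mem_closure_ball_inter_cone (half_pos hch.pos), fun y hy z ⟨hz, hcone⟩ hyz => ?_⟩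
    obtain ⟨hyr, hyzr⟩ := hball hz hyz
    have hle := height_add_le (R := R) hch.lipschitz y z
    rw [hch.mem_iff _ hyzr]
    linarith [hch.height_nonpos hyr hy, hcone.out]

end Charts

section ZeroGradient

variable {d : ℕ} {w : E d → ℝ}

theorem IsWeakGradientOn.ae_eq_zero_of_hasCompactSupport (hd : 0 < d)
    (h : IsWeakGradientOn univ w 0) (hw : LocallyIntegrable w) (hwc : HasCompactSupport w) :
    w =ᵐ[volume] 0 := by
  have : Nonempty (Fin d) := ⟨⟨0, hd⟩⟩
  have hconv (ρ : E d → ℝ) (hρ : IsTest univ ρ) (x : E d) : (ρ ⋆[lsmul ℝ ℝ, volume] w) x = 0 := by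
    have hρw := hρ.convolution hw hwc fun z _ y _ => mem_univ (y + z)
    have hfderiv (y : E d) : fderiv ℝ (ρ ⋆[lsmul ℝ ℝ, volume] w) y = 0 := by
      refine (InnerProductSpace.toDual ℝ (E d)).symm.map_eq_zero_iff.1 ?_
      change gradient (ρ ⋆[lsmul ℝ ℝ, volume] w) y = 0
      rw [h.gradient_convolution hw hρ fun t _ => mem_univ (y - t), convolution_zero, Pi.zero_apply]
    obtain ⟨y, hy⟩ := (ne_univ_iff_exists_notMem _).1 hρw.hasCompactSupport.isCompact.ne_univ
    rw [is_const_of_fderiv_eq_zero (fun z => hρw.differentiableAt z) hfderiv x y,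
      image_eq_zero_of_notMem_tsupport hy]
  refine ae_eq_zero_of_integral_contDiff_smul_eq_zero hw fun φ hφ hφc => ?_
  have hφ' : IsTest univ fun t => φ (0 - t) :=
    IsTest.const_sub ⟨hφ, hφc, subset_univ _⟩ fun t _ => mem_univ (0 - t)
  simpa only [convolution_lsmul_swap, zero_sub, neg_neg] using hconv _ hφ' 0

end ZeroGradient

section LipschitzGraph

variable {d : ℕ} {R : E d ≃ₗᵢ[ℝ] WithLp 2 (E (d - 1) × ℝ)} {K : NNReal} {γ : E (d - 1) → ℝ}
  {F : E d → ℝ}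

/-- The parametrisation of the graph of `γ`, in the coordinates given by `R`. -/
def graphMap (R : E d ≃ₗᵢ[ℝ] WithLp 2 (E (d - 1) × ℝ)) (γ : E (d - 1) → ℝ) (z : E (d - 1)) : E d :=
  R.symm (WithLp.toLp 2 (z, γ z))

/-- The point over `p.1` of height `p.2` above the graph of `γ`. -/
def chartMap (R : E d ≃ₗᵢ[ℝ] WithLp 2 (E (d - 1) × ℝ)) (γ : E (d - 1) → ℝ) (p : E (d - 1) × ℝ) :
    E d :=
  graphMap R γ p.1 + p.2 • up R

theorem norm_up : ‖up R‖ = 1 := by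
  rw [up, LinearIsometryEquiv.norm_map, WithLp.prod_norm_eq_of_L2]
  simp

theorem lipschitzWith_fst_coord : LipschitzWith 1 fun y => (R y).fst :=
  LipschitzWith.of_dist_le_mul fun y z => by
    rw [NNReal.coe_one, one_mul, ← R.dist_map y z, dist_eq_norm, dist_eq_norm]
    exact WithLp.norm_fst_le _ (R y - R z)

theorem fst_graphMap (z : E (d - 1)) : (R (graphMap R γ z)).fst = z := by
  simp [graphMap]

theorem height_graphMap (z : E (d - 1)) : height R γ (graphMap R γ z) = 0 := by
  simp [graphMap, height]

theorem height_chartMap (p : E (d - 1) × ℝ) : height R γ (chartMap R γ p) = p.2 := by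
  rw [chartMap, height_add_smul_up, height_graphMap, zero_add]

theorem graphMap_fst {y : E d} (hy : height R γ y = 0) : graphMap R γ (R y).fst = y := by
  rw [height, sub_eq_zero] at hy
  rw [graphMap, ← hy]
  exact R.symm_apply_apply y

theorem lipschitzWith_graphMap (hγ : LipschitzWith K γ) : LipschitzWith (1 + K) (graphMap R γ) := by
  refine LipschitzWith.of_dist_le_mul fun y z => ?_
  have hγyz : ‖γ y - γ z‖ ≤ K * ‖y - z‖ := by
    simpa only [dist_eq_norm] using hγ.dist_le_mul y z
  rw [graphMap, graphMap, LinearIsometryEquiv.dist_map, dist_eq_norm, dist_eq_norm,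
    ← WithLp.toLp_sub, WithLp.prod_norm_eq_of_L2, Prod.mk_sub_mk, NNReal.coe_add, NNReal.coe_one,
    one_add_mul]
  refine Real.sqrt_le_iff.2 ⟨by positivity, ?_⟩
  change ‖y - z‖ ^ 2 + ‖γ y - γ z‖ ^ 2 ≤ _
  nlinarith [norm_nonneg (y - z), norm_nonneg (γ y - γ z)]

theorem antilipschitzWith_graphMap : AntilipschitzWith 1 (graphMap R γ) :=
  AntilipschitzWith.of_le_mul_dist fun y z => by
    simpa only [fst_graphMap] using
      (lipschitzWith_fst_coord (R := R)).dist_le_mul (graphMap R γ y) (graphMap R γ z)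

theorem isClosedEmbedding_graphMap (hγ : LipschitzWith K γ) : IsClosedEmbedding (graphMap R γ) :=
  antilipschitzWith_graphMap.isClosedEmbedding (lipschitzWith_graphMap hγ).uniformContinuous

theorem measurePreserving_chartMap (hγ : Continuous γ) :
    MeasurePreserving (chartMap R γ) (volume.prod volume) volume := by
  have hshear : MeasurePreserving (fun p : E (d - 1) × ℝ => (id p.1, γ p.1 + p.2))
      (volume.prod volume) (volume.prod volume) :=
    (MeasurePreserving.id volume).skew_product
      (g := fun z t => γ z + t) (by unfold Function.uncurry; fun_prop)
      (.of_forall fun z => (measurePreserving_add_left volume (γ z)).map_eq)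
  have heq : chartMap R γ = fun p => R.symm (WithLp.toLp 2 (p.1, γ p.1 + p.2)) := by
    ext1 p
    rw [chartMap, graphMap, up, ← map_smul, ← map_add, ← WithLp.toLp_smul, ← WithLp.toLp_add]
    simp
  rw [heq]
  exact R.symm.measurePreserving.comp ((WithLp.volume_preserving_toLp (E (d - 1)) ℝ).comp hshear)

theorem measurePreserving_chartMap_subgraph (hγ : Continuous γ) :
    MeasurePreserving (chartMap R γ) (volume.prod (volume.restrict (Iio 0)))
      (volume.restrict {y | height R γ y < 0}) := by
  have hpre : chartMap R γ ⁻¹' {y | height R γ y < 0} = univ ×ˢ Iio 0 := by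
    ext p
    simp [height_chartMap]
  have := (measurePreserving_chartMap (R := R) hγ).restrict_preimage
    (measurableSet_lt (continuous_height (R := R) hγ).measurable (measurable_const (a := 0)))
  rwa [hpre, ← Measure.prod_restrict, Measure.restrict_univ] at this

theorem hasDerivAt_comp_add_smul (hF : Differentiable ℝ F) (y v : E d) (t : ℝ) :
    HasDerivAt (fun s : ℝ => F (y + s • v)) (fderiv ℝ F (y + t • v) v) t :=
  (hF _).hasFDerivAt.comp_hasDerivAt t
    (by simpa using ((hasDerivAt_id t).smul_const v).const_add y)

theorem IsTest.integral_Iio_fderiv_up (hF : IsTest univ F) (y : E d) :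
    ∫ t in Iio (0 : ℝ), fderiv ℝ F (y + t • up R) (up R) = F y := by
  have hline : Isometry fun t : ℝ => y + t • up R := Isometry.of_dist_eq fun s t => by
    rw [dist_add_left, dist_eq_norm, ← sub_smul, norm_smul, norm_up, mul_one, dist_eq_norm]
  have hcomp : ContDiff ℝ 1 fun t : ℝ => F (y + t • up R) :=
    (hF.contDiff.of_le (by simp)).comp (contDiff_const.add (contDiff_id.smul contDiff_const))
  have hderiv : deriv (fun t : ℝ => F (y + t • up R)) =
      fun t => fderiv ℝ F (y + t • up R) (up R) :=
    funext fun t => (hasDerivAt_comp_add_smul (fun z => hF.differentiableAt z) y _ t).deriv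
  rw [← integral_Iic_eq_integral_Iio, ← hderiv,
    (hF.hasCompactSupport.comp_isClosedEmbedding hline.isClosedEmbedding).integral_Iic_deriv_eq
      hcomp 0, zero_smul, add_zero]

theorem integral_lineDeriv_eq_zero {V : Type*} [NormedAddCommGroup V] [NormedSpace ℝ V]
    [FiniteDimensional ℝ V] [MeasurableSpace V] [BorelSpace V] {μ : Measure V} [μ.IsAddHaarMeasure]
    {g : V → ℝ} (hg : LipschitzWith K g) (hgc : HasCompactSupport g) (v : V) :
    ∫ x, lineDeriv ℝ g x v ∂μ = 0 := by
  have hconst (x : V) : lineDeriv ℝ (fun _ : V => (1 : ℝ)) x (-v) = 0 := by simp [lineDeriv]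
  simpa [hconst] using
    ((LipschitzWith.const' (K := 0) (1 : ℝ)).integral_lineDeriv_mul_eq (μ := μ) hg hgc (-v)).symm

/-- The component along `up R` of `v` minus its tangential lift: up to a positive factor, the scalar
product of `v` with the unit normal to the graph of `γ` pointing upwards. -/
def normalComponent (R : E d ≃ₗᵢ[ℝ] WithLp 2 (E (d - 1) × ℝ)) (γ : E (d - 1) → ℝ) (v : E d)
    (z : E (d - 1)) : ℝ :=
  (R v).snd - lineDeriv ℝ γ z (R v).fst

theorem hasLineDerivAt_comp_graphMap {z : E (d - 1)} {v : E d}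
    (hγz : LineDifferentiableAt ℝ γ z (R v).fst) (hF : DifferentiableAt ℝ F (graphMap R γ z)) :
    HasLineDerivAt ℝ (fun z => F (graphMap R γ z)) (fderiv ℝ F (graphMap R γ z) v
      - normalComponent R γ v z * fderiv ℝ F (graphMap R γ z) (up R)) z (R v).fst := by
  have hgraph (s : ℝ) : graphMap R γ (z + s • (R v).fst) = graphMap R γ z
      + (s • (v - (R v).snd • up R) + (γ (z + s • (R v).fst) - γ z) • up R) := by
    refine R.injective (WithLp.ofLp_injective 2 (Prod.ext ?_ ?_)) <;> simp [graphMap, up]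
  have hline : HasDerivAt (fun s : ℝ => graphMap R γ (z + s • (R v).fst))
      (v - normalComponent R γ v z • up R) 0 := by
    simp only [hgraph]
    refine ((((hasDerivAt_id (0 : ℝ)).smul_const (v - (R v).snd • up R)).add
      ((hγz.hasLineDerivAt.sub_const (γ z)).smul_const (up R))).const_add
        (graphMap R γ z)).congr_deriv ?_
    rw [normalComponent]
    module
  have hcomp := HasFDerivAt.comp_hasDerivAt (f := fun s : ℝ => graphMap R γ (z + s • (R v).fst)) 0
    (by simpa using hF.hasFDerivAt) hline
  rwa [map_sub, map_smul, smul_eq_mul] at hcomp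

theorem IsTest.integral_graph_fderiv (hγ : LipschitzWith K γ) (hF : IsTest univ F) (v : E d) :
    ∫ z, (fderiv ℝ F (graphMap R γ z) v
      - normalComponent R γ v z * fderiv ℝ F (graphMap R γ z) (up R)) = 0 := by
  obtain ⟨L, hL⟩ := hF.contDiff.lipschitzWith_of_hasCompactSupport hF.hasCompactSupport (by simp)
  rw [← integral_lineDeriv_eq_zero (μ := volume) (hL.comp (lipschitzWith_graphMap (R := R) hγ))
    (hF.hasCompactSupport.comp_isClosedEmbedding (isClosedEmbedding_graphMap hγ)) (R v).fst]
  refine integral_congr_ae ?_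
  filter_upwards [hγ.ae_lineDifferentiableAt (μ := volume) (R v).fst] with z hz
  exact (hasLineDerivAt_comp_graphMap hz (hF.differentiableAt _)).lineDeriv.symm

theorem norm_normalComponent_le (hγ : LipschitzWith K γ) (v : E d) (z : E (d - 1)) :
    ‖normalComponent R γ v z‖ ≤ (1 + K) * ‖v‖ := by
  have hsnd : ‖(R v).snd‖ ≤ ‖v‖ := (WithLp.norm_snd_le _ (R v)).trans_eq (R.norm_map v)
  have hfst : ‖(R v).fst‖ ≤ ‖v‖ := (WithLp.norm_fst_le _ (R v)).trans_eq (R.norm_map v)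
  calc ‖normalComponent R γ v z‖ ≤ ‖(R v).snd‖ + ‖lineDeriv ℝ γ z (R v).fst‖ := norm_sub_le _ _
    _ ≤ ‖v‖ + K * ‖v‖ := add_le_add hsnd
        ((norm_lineDeriv_le_of_lipschitz ℝ hγ).trans (by gcongr))
    _ = (1 + K) * ‖v‖ := by ring

theorem IsTest.integrable_fderiv (hF : IsTest univ F) (v : E d) :
    Integrable fun y => fderiv ℝ F y v :=
  ((hF.contDiff.continuous_fderiv (by simp)).clm_apply
    continuous_const).integrable_of_hasCompactSupport (hF.hasCompactSupport.fderiv_apply ℝ v)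

/-- The divergence theorem for the vector field `F • v` on the region below a Lipschitz graph. -/
theorem IsTest.integral_subgraph_fderiv (hγ : LipschitzWith K γ) (hF : IsTest univ F) (v : E d) :
    ∫ y in {y | height R γ y < 0}, fderiv ℝ F y v
      = ∫ z, normalComponent R γ v z * F (graphMap R γ z) := by
  have hmp := measurePreserving_chartMap_subgraph (R := R) hγ.continuous
  have hint (u : E d) : Integrable (fun p => fderiv ℝ F (chartMap R γ p) u)
      (volume.prod (volume.restrict (Iio 0))) :=
    hmp.integrable_comp_of_integrable (hF.integrable_fderiv u).restrict
  have hnormal : Integrable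
      (fun p => normalComponent R γ v p.1 * fderiv ℝ F (chartMap R γ p) (up R))
      (volume.prod (volume.restrict (Iio 0))) :=
    (hint (up R)).bdd_mul (c := (1 + K) * ‖v‖) (((measurable_lineDeriv hγ.continuous).const_sub
        (R v).snd).comp measurable_fst).aestronglyMeasurable
      (.of_forall fun p => norm_normalComponent_le hγ v p.1)
  have hslice (t : ℝ) : ∫ z, (fderiv ℝ F (chartMap R γ (z, t)) v
      - normalComponent R γ v z * fderiv ℝ F (chartMap R γ (z, t)) (up R)) = 0 := by
    have hFt : IsTest univ fun y => F (y + t • up R) :=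
      ⟨hF.contDiff.comp (contDiff_id.add contDiff_const),
        hF.hasCompactSupport.comp_homeomorph (Homeomorph.addRight _), subset_univ _⟩
    simpa only [chartMap, fderiv_comp_add_right] using hFt.integral_graph_fderiv hγ v
  calc ∫ y in {y | height R γ y < 0}, fderiv ℝ F y v
      = ∫ p, fderiv ℝ F (chartMap R γ p) v ∂(volume.prod (volume.restrict (Iio 0))) := by
        rw [← hmp.map_eq, integral_map hmp.aemeasurable
          (hmp.map_eq ▸ (hF.integrable_fderiv v).restrict.1)]
    _ = ∫ p, normalComponent R γ v p.1 * fderiv ℝ F (chartMap R γ p) (up R)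
          ∂(volume.prod (volume.restrict (Iio 0))) := by
        rw [← sub_eq_zero, ← integral_sub (hint v) hnormal,
          integral_prod_symm (fun p => _ - _) ((hint v).sub hnormal)]
        simp only [hslice, integral_zero]
    _ = ∫ z, normalComponent R γ v z * F (graphMap R γ z) := by
        rw [integral_prod _ hnormal]
        simp only [integral_const_mul, chartMap, hF.integral_Iio_fderiv_up]

end LipschitzGraph

section BoundaryEstimates

variable {d : ℕ} {Ω : Set (E d)} {x : E d} {r : ℝ} {R : E d ≃ₗᵢ[ℝ] WithLp 2 (E (d - 1) × ℝ)}
  {K : NNReal} {γ : E (d - 1) → ℝ} {F : E d → ℝ}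

theorem euclideanHausdorffMeasure_image_le {X Y : Type*} [EMetricSpace X] [MeasurableSpace X]
    [BorelSpace X] [EMetricSpace Y] [MeasurableSpace Y] [BorelSpace Y] {L : NNReal} {f : X → Y}
    (hf : LipschitzWith L f) (n : ℕ) (s : Set X) :
    Measure.euclideanHausdorffMeasure n (f '' s) ≤
      (L : ENNReal) ^ n * Measure.euclideanHausdorffMeasure n s := by
  have := hf.hausdorffMeasure_image_le (d := n) n.cast_nonneg s
  rw [ENNReal.rpow_natCast] at this
  simp only [Measure.euclideanHausdorffMeasure_def, Measure.smul_apply, ENNReal.smul_def,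
    smul_eq_mul]
  rw [mul_left_comm]
  gcongr

theorem IsChart.surface_restrict_le (h : IsChart Ω x r R K γ) (hΩ : IsOpen Ω) :
    (surface Ω).restrict (Metric.ball x r) ≤
      ((1 + K) ^ (d - 1) : NNReal) • (volume : Measure (E (d - 1))).map (graphMap R γ) := by
  have hgraph := lipschitzWith_graphMap (R := R) h.lipschitz
  refine Measure.le_iff.2 fun A hA => ?_
  have hsub : A ∩ Metric.ball x r ∩ frontier Ω ⊆ graphMap R γ '' (graphMap R γ ⁻¹' A) := by
    rintro y ⟨⟨hyA, hyr⟩, hyΩ⟩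
    have hy := graphMap_fst ((h.mem_frontier_iff hΩ hyr).1 hyΩ)
    exact ⟨(R y).fst, by rwa [mem_preimage, hy], hy⟩
  rw [Measure.restrict_apply hA, surface, Measure.restrict_apply (hA.inter measurableSet_ball),
    Measure.smul_apply, Measure.map_apply hgraph.continuous.measurable hA,
    ← EuclideanSpace.euclideanHausdorffMeasure_eq_volume]
  refine (measure_mono hsub).trans ((euclideanHausdorffMeasure_image_le hgraph _ _).trans_eq ?_)
  rw [ENNReal.smul_def, smul_eq_mul, ENNReal.coe_pow]

theorem IsChart.map_graphMap_restrict_le (h : IsChart Ω x r R K γ) (hΩ : IsOpen Ω) :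
    ((volume : Measure (E (d - 1))).map (graphMap R γ)).restrict (Metric.ball x r) ≤
      surface Ω := by
  have hgraph := (lipschitzWith_graphMap (R := R) h.lipschitz).continuous.measurable
  refine Measure.le_iff.2 fun A hA => ?_
  have hsub : graphMap R γ ⁻¹' (A ∩ Metric.ball x r) ⊆ (fun y => (R y).fst) '' (A ∩ frontier Ω) :=
    fun z ⟨hzA, hzr⟩ => ⟨graphMap R γ z,
      ⟨hzA, (h.mem_frontier_iff hΩ hzr).2 (height_graphMap z)⟩, fst_graphMap z⟩
  rw [Measure.restrict_apply hA, surface, Measure.restrict_apply hA,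
    Measure.map_apply hgraph (hA.inter measurableSet_ball),
    ← EuclideanSpace.euclideanHausdorffMeasure_eq_volume]
  refine (measure_mono hsub).trans
    ((euclideanHausdorffMeasure_image_le lipschitzWith_fst_coord _ _).trans_eq ?_)
  rw [ENNReal.coe_one, one_pow, one_mul]

theorem IsBoundedLipschitzDomain.isCompact_frontier (hΩ : IsBoundedLipschitzDomain Ω) :
    IsCompact (frontier Ω) :=
  hΩ.isBounded.isCompact_closure.of_isClosed_subset isClosed_frontier frontier_subset_closure

theorem IsBoundedLipschitzDomain.isFiniteMeasure_surface (hΩ : IsBoundedLipschitzDomain Ω) :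
    IsFiniteMeasure (surface Ω) := by
  have hlt : surface Ω (frontier Ω) < ⊤ := by
    refine hΩ.isCompact_frontier.measure_lt_top_of_nhdsWithin fun x hx => ?_
    obtain ⟨r, R, K, γ, h⟩ := hΩ.exists_isChart hx
    refine ⟨Metric.ball x r, mem_nhdsWithin_of_mem_nhds (Metric.ball_mem_nhds x h.pos), ?_⟩
    have hle := h.surface_restrict_le hΩ.isOpen (Metric.ball x r)
    rw [Measure.restrict_apply_self, Measure.smul_apply, Measure.map_apply
      (lipschitzWith_graphMap h.lipschitz).continuous.measurable measurableSet_ball,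
      ENNReal.smul_def, smul_eq_mul] at hle
    exact hle.trans_lt (ENNReal.mul_lt_top ENNReal.coe_lt_top
      (antilipschitzWith_graphMap.isBounded_preimage Metric.isBounded_ball).measure_lt_top)
  refine ⟨?_⟩
  rw [surface, Measure.restrict_apply_univ]
  rwa [surface, Measure.restrict_apply_self] at hlt

theorem IsBoundedLipschitzDomain.integrable_surface {V : Type*} [NormedAddCommGroup V]
    (hΩ : IsBoundedLipschitzDomain Ω) {f : E d → V} (hf : Continuous f) :
    Integrable f (surface Ω) := by
  have := hΩ.isFiniteMeasure_surface
  have hint := hf.continuousOn.integrableOn_compact (μ := surface Ω) hΩ.isCompact_frontier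
  rwa [IntegrableOn, surface, Measure.restrict_restrict measurableSet_frontier, inter_self] at hint

theorem IsBoundedLipschitzDomain.integrableOn {V : Type*} [NormedAddCommGroup V]
    (hΩ : IsBoundedLipschitzDomain Ω) {f : E d → V} (hf : Continuous f) : IntegrableOn f Ω :=
  (hf.continuousOn.integrableOn_compact hΩ.isBounded.isCompact_closure).mono_set subset_closure

theorem integrable_comp_graphMap (hγ : LipschitzWith K γ) (hF : Continuous F)
    (hFc : HasCompactSupport F) : Integrable fun z => F (graphMap R γ z) :=
  (hF.comp (lipschitzWith_graphMap hγ).continuous).integrable_of_hasCompactSupport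
    (hFc.comp_isClosedEmbedding (isClosedEmbedding_graphMap hγ))

theorem IsTest.setIntegral_eq {μ : Measure (E d)} {O : Set (E d)} (hF : IsTest O F) :
    ∫ y in O, |F y| ∂μ = ∫ y, |F y| ∂μ :=
  setIntegral_eq_integral_of_forall_compl_eq_zero fun y hy => by
    rw [image_eq_zero_of_notMem_tsupport fun hy' => hy (hF.tsupport_subset hy'), abs_zero]

theorem IsChart.integral_surface_le (h : IsChart Ω x r R K γ) (hΩ : IsOpen Ω)
    (hF : IsTest (Metric.ball x r) F) :
    ∫ y, |F y| ∂(surface Ω) ≤ (1 + K) ^ (d - 1) * ∫ z, |F (graphMap R γ z)| := by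
  have hgraph := (lipschitzWith_graphMap (R := R) h.lipschitz).continuous.measurable
  have hFs := hF.contDiff.continuous.abs.aestronglyMeasurable (μ := volume.map (graphMap R γ))
  have hle := integral_mono_measure (h.surface_restrict_le hΩ)
    (.of_forall fun y => abs_nonneg (F y))
    (((integrable_map_measure hFs hgraph.aemeasurable).2
      (integrable_comp_graphMap h.lipschitz hF.contDiff.continuous
        hF.hasCompactSupport).abs).smul_measure_nnreal)
  rw [hF.setIntegral_eq, integral_smul_nnreal_measure, integral_map hgraph.aemeasurable hFs] at hle
  simpa [NNReal.smul_def] using hle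

theorem IsChart.integral_comp_graphMap_le (h : IsChart Ω x r R K γ) (hΩ : IsOpen Ω)
    [IsFiniteMeasure (surface Ω)] (hF : IsTest (Metric.ball x r) F) :
    ∫ z, |F (graphMap R γ z)| ≤ ∫ y, |F y| ∂(surface Ω) := by
  have hgraph := (lipschitzWith_graphMap (R := R) h.lipschitz).continuous.measurable
  have hle := integral_mono_measure (h.map_graphMap_restrict_le hΩ)
    (.of_forall fun y => abs_nonneg (F y))
    (hF.contDiff.continuous.integrable_of_hasCompactSupport hF.hasCompactSupport).abs
  rwa [hF.setIntegral_eq, integral_map hgraph.aemeasurable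
    hF.contDiff.continuous.abs.aestronglyMeasurable] at hle

theorem IsTest.fderiv_eq_zero {O : Set (E d)} (hF : IsTest O F) {y : E d} (hy : y ∉ O) :
    fderiv ℝ F y = 0 :=
  Function.notMem_support.1 fun h0 => hy (hF.tsupport_subset (support_fderiv_subset ℝ h0))

theorem IsChart.setIntegral_fderiv (h : IsChart Ω x r R K γ) (hΩ : IsOpen Ω)
    (hF : IsTest (Metric.ball x r) F) (v : E d) :
    ∫ y in Ω, fderiv ℝ F y v = ∫ z, normalComponent R γ v z * F (graphMap R γ z) := by
  rw [← (hF.mono (subset_univ _)).integral_subgraph_fderiv h.lipschitz,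
    ← integral_indicator hΩ.measurableSet, ← integral_indicator
      (measurableSet_lt (continuous_height h.lipschitz.continuous).measurable measurable_const)]
  congr 1 with y
  by_cases hy : y ∈ Metric.ball x r
  · simp only [indicator, h.mem_iff y hy, mem_ofPred_eq]
  · simp only [indicator, hF.fderiv_eq_zero hy, zero_apply, ite_self]

theorem norm_le_of_forall_inner_le {V : Type*} [NormedAddCommGroup V] [InnerProductSpace ℝ V]
    {u : V} {C : ℝ} (hC : 0 ≤ C) (h : ∀ v, |inner ℝ u v| ≤ C * ‖v‖) : ‖u‖ ≤ C := by
  rw [← innerSL_apply_norm ℝ u]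
  exact opNorm_le_bound _ hC h

theorem IsTest.integrable_gradient {μ : Measure (E d)} [IsFiniteMeasureOnCompacts μ]
    (hF : IsTest univ F) : Integrable (gradient F) μ :=
  (continuous_gradient (hF.contDiff.of_le (by simp))).integrable_of_hasCompactSupport
    (hasCompactSupport_gradient hF.hasCompactSupport)

theorem IsTest.inner_setIntegral_gradient (hF : IsTest univ F) (v : E d) :
    inner ℝ (∫ y in Ω, gradient F y) v = ∫ y in Ω, fderiv ℝ F y v := by
  simp only [real_inner_comm v, ← integral_inner hF.integrable_gradient, inner_gradient_right]
  simp

theorem IsChart.norm_setIntegral_gradient_le (h : IsChart Ω x r R K γ) (hΩ : IsOpen Ω)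
    [IsFiniteMeasure (surface Ω)] (hF : IsTest (Metric.ball x r) F) :
    ‖∫ y in Ω, gradient F y‖ ≤ (1 + K) * ∫ y, |F y| ∂(surface Ω) := by
  refine norm_le_of_forall_inner_le
    (mul_nonneg (by positivity) (integral_nonneg fun y => abs_nonneg _)) fun v => ?_
  calc |inner ℝ (∫ y in Ω, gradient F y) v|
      = ‖∫ z, normalComponent R γ v z * F (graphMap R γ z)‖ := by
        rw [(hF.mono (subset_univ _)).inner_setIntegral_gradient, h.setIntegral_fderiv hΩ hF,
          Real.norm_eq_abs]
    _ ≤ ∫ z, (1 + K) * ‖v‖ * |F (graphMap R γ z)| := by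
        refine norm_integral_le_of_norm_le ((integrable_comp_graphMap h.lipschitz
          hF.contDiff.continuous hF.hasCompactSupport).abs.const_mul _) (.of_forall fun z => ?_)
        rw [norm_mul, ← Real.norm_eq_abs]
        gcongr
        exact norm_normalComponent_le h.lipschitz v z
    _ ≤ (1 + K) * ‖v‖ * ∫ y, |F y| ∂(surface Ω) := by
        rw [integral_const_mul]
        gcongr
        exact h.integral_comp_graphMap_le hΩ hF
    _ = (1 + K) * (∫ y, |F y| ∂(surface Ω)) * ‖v‖ := by ring

theorem IsChart.integral_surface_le_integral_norm_gradient (h : IsChart Ω x r R K γ)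
    (hΩ : IsOpen Ω) (hF : IsTest (Metric.ball x r) F) (hF0 : ∀ y, 0 ≤ F y) :
    ∫ y, F y ∂(surface Ω) ≤ (1 + K) ^ (d - 1) * ∫ y in Ω, ‖gradient F y‖ := by
  have hle := h.integral_surface_le hΩ hF
  simp only [abs_of_nonneg (hF0 _)] at hle
  refine hle.trans ?_
  gcongr
  calc ∫ z, F (graphMap R γ z) = inner ℝ (∫ y in Ω, gradient F y) (up R) := by
        rw [(hF.mono (subset_univ _)).inner_setIntegral_gradient, h.setIntegral_fderiv hΩ hF]
        simp [normalComponent, up, lineDeriv]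
    _ ≤ ‖∫ y in Ω, gradient F y‖ := by
        simpa only [norm_up, mul_one] using
          real_inner_le_norm (∫ y in Ω, gradient F y) (up R)
    _ ≤ ∫ y in Ω, ‖gradient F y‖ := norm_integral_le_integral_norm _

theorem IsTest.setIntegral_gradient_eq_zero (hF : IsTest Ω F) :
    ∫ y in Ω, gradient F y = 0 := by
  rw [setIntegral_eq_integral_of_forall_compl_eq_zero fun y hy => by
    rw [gradient, hF.fderiv_eq_zero hy, map_zero], ← Measure.restrict_univ (μ := volume)]
  refine ext_inner_right ℝ fun v => ?_
  obtain ⟨L, hL⟩ := hF.contDiff.lipschitzWith_of_hasCompactSupport hF.hasCompactSupport (by simp)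
  have h0 := integral_lineDeriv_eq_zero (μ := volume) hL hF.hasCompactSupport v
  simp only [(hF.differentiableAt _).lineDeriv_eq_fderiv] at h0
  rw [(hF.mono (subset_univ _)).inner_setIntegral_gradient, Measure.restrict_univ, h0,
    inner_zero_left]

theorem gradient_eq_sum_gradient_mul {ι : Type*} [Fintype ι] {η : ι → E d → ℝ}
    (hη : ∀ i, Differentiable ℝ (η i)) {y : E d} (hF : DifferentiableAt ℝ F y)
    (hsum : ∀ᶠ z in 𝓝 y, ∑ i, η i z = 1) :
    gradient F y = ∑ i, gradient (fun z => η i z * F z) y := by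
  simp only [gradient_fun_mul (hη _ y) hF, Finset.sum_add_distrib, ← Finset.sum_smul,
    ← Finset.smul_sum, sum_gradient_eq_zero hη hsum, hsum.self_of_nhds, one_smul, smul_zero,
    add_zero]

theorem IsBoundedLipschitzDomain.exists_nhds_norm_setIntegral_gradient_le
    (hΩ : IsBoundedLipschitzDomain Ω) (hx : x ∈ closure Ω) : ∃ U ∈ 𝓝 x, ∃ C : ℝ, 0 ≤ C ∧
      ∀ F, IsTest U F → ‖∫ y in Ω, gradient F y‖ ≤ C * ∫ y, |F y| ∂(surface Ω) := by
  have := hΩ.isFiniteMeasure_surface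
  by_cases hxΩ : x ∈ Ω
  · exact ⟨Ω, hΩ.isOpen.mem_nhds hxΩ, 0, le_rfl, fun F hF => by
      rw [hF.setIntegral_gradient_eq_zero, norm_zero, zero_mul]⟩
  · obtain ⟨r, R, K, γ, h⟩ := hΩ.exists_isChart (x := x)
      (by rw [hΩ.isOpen.frontier_eq]; exact ⟨hx, hxΩ⟩)
    exact ⟨Metric.ball x r, Metric.ball_mem_nhds x h.pos, 1 + K, by positivity,
      fun F hF => h.norm_setIntegral_gradient_le hΩ.isOpen hF⟩

theorem IsBoundedLipschitzDomain.exists_norm_setIntegral_gradient_le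
    (hΩ : IsBoundedLipschitzDomain Ω) : ∃ C : ℝ, 0 ≤ C ∧ ∀ F : E d → ℝ, ContDiff ℝ ∞ F →
      ‖∫ y in Ω, gradient F y‖ ≤ C * ∫ y, |F y| ∂(surface Ω) := by
  have := hΩ.isFiniteMeasure_surface
  choose! U hU C hC hloc using fun x (hx : x ∈ closure Ω) =>
    hΩ.exists_nhds_norm_setIntegral_gradient_le hx
  obtain ⟨ι, _, c, η, hc, hη, hη0, hsum⟩ :=
    exists_smooth_partition hΩ.isBounded.isCompact_closure U hU
  refine ⟨∑ i, C (c i), Finset.sum_nonneg fun i _ => hC _ (hc i), fun F hF => ?_⟩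
  have hFη (i : ι) := (hη i).mul hF
  calc ‖∫ y in Ω, gradient F y‖ = ‖∑ i, ∫ y in Ω, gradient (fun z => η i z * F z) y‖ := by
        rw [← integral_finsetSum _ fun i _ => ((hFη i).mono (subset_univ _)).integrable_gradient]
        congr 1
        refine setIntegral_congr_fun hΩ.isOpen.measurableSet fun y hy => ?_
        exact gradient_eq_sum_gradient_mul (fun i z => (hη i).differentiableAt z)
          (hF.differentiable (by simp) y) (Filter.mem_of_superset (hΩ.isOpen.mem_nhds hy)
            fun z hz => hsum z (subset_closure hz))
    _ ≤ ∑ i, C (c i) * ∫ y, |η i y * F y| ∂(surface Ω) :=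
        norm_sum_le_of_le _ fun i _ => hloc _ (hc i) _ (hFη i)
    _ ≤ ∑ i, C (c i) * ∫ y, |F y| ∂(surface Ω) := by
        refine Finset.sum_le_sum fun i _ => mul_le_mul_of_nonneg_left
          (integral_mono_ae ((hFη i).contDiff.continuous.abs.integrable_of_hasCompactSupport
            (hFη i).hasCompactSupport.norm) (hΩ.integrable_surface hF.continuous.abs) ?_)
          (hC _ (hc i))
        filter_upwards [ae_restrict_mem measurableSet_frontier] with y hy
        have hηle : η i y ≤ 1 := (hsum y (frontier_subset_closure hy)).subst
          (Finset.single_le_sum (f := fun j => η j y) (fun j _ => hη0 j y) (Finset.mem_univ i))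
        rw [abs_mul, abs_of_nonneg (hη0 i y)]
        exact mul_le_of_le_one_left (abs_nonneg _) hηle
    _ = (∑ i, C (c i)) * ∫ y, |F y| ∂(surface Ω) := (Finset.sum_mul ..).symm

theorem IsTest.exists_forall_abs_le_and_norm_gradient_le {O : Set (E d)} (hF : IsTest O F) :
    ∃ M : ℝ, ∀ y, |F y| ≤ M ∧ ‖gradient F y‖ ≤ M := by
  obtain ⟨M₀, hM₀⟩ := hF.hasCompactSupport.exists_bound_of_continuous hF.contDiff.continuous
  obtain ⟨M₁, hM₁⟩ := (hasCompactSupport_gradient hF.hasCompactSupport).exists_bound_of_continuous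
    (continuous_gradient (hF.contDiff.of_le (by simp)))
  exact ⟨max M₀ M₁, fun y => ⟨(hM₀ y).trans (le_max_left _ _), (hM₁ y).trans (le_max_right _ _)⟩⟩

theorem IsBoundedLipschitzDomain.exists_integral_surface_le
    (hΩ : IsBoundedLipschitzDomain Ω) : ∃ C : ℝ, 0 ≤ C ∧ ∀ F : E d → ℝ, ContDiff ℝ ∞ F →
      (∀ y, 0 ≤ F y) → ∫ y, F y ∂(surface Ω) ≤ C * ∫ y in Ω, (F y + ‖gradient F y‖) := by
  choose! r R K γ h using fun x (hx : x ∈ frontier Ω) => hΩ.exists_isChart hx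
  obtain ⟨ι, _, c, η, hc, hη, hη0, hsum⟩ := exists_smooth_partition hΩ.isCompact_frontier
    (fun x => Metric.ball x (r x)) fun x hx => Metric.ball_mem_nhds x (h x hx).pos
  choose M hM using fun i => (hη i).exists_forall_abs_le_and_norm_gradient_le
  have hM0 (i : ι) : 0 ≤ M i := (abs_nonneg _).trans (hM i 0).1
  refine ⟨∑ i, (1 + K (c i)) ^ (d - 1) * M i, Finset.sum_nonneg fun i _ =>
    mul_nonneg (by positivity) (hM0 i), fun F hF hF0 => ?_⟩
  have hFη (i : ι) := (hη i).mul hF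
  have hint : IntegrableOn (fun y => F y + ‖gradient F y‖) Ω :=
    hΩ.integrableOn (hF.continuous.add (continuous_gradient (hF.of_le (by simp))).norm)
  have hgrad (i : ι) (y : E d) :
      ‖gradient (fun z => η i z * F z) y‖ ≤ M i * (F y + ‖gradient F y‖) := by
    rw [gradient_fun_mul ((hη i).differentiableAt y) (hF.differentiable (by simp) y), mul_add]
    refine (norm_add_le _ _).trans ?_
    rw [norm_smul, norm_smul, Real.norm_eq_abs, Real.norm_eq_abs, abs_of_nonneg (hF0 y)]
    nlinarith [hM i y, hF0 y, norm_nonneg (gradient F y)]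
  calc ∫ y, F y ∂(surface Ω) = ∑ i, ∫ y, η i y * F y ∂(surface Ω) := by
        rw [← integral_finsetSum _ fun i _ => hΩ.integrable_surface (hFη i).contDiff.continuous]
        refine setIntegral_congr_fun measurableSet_frontier fun y hy => ?_
        simp only [← Finset.sum_mul, hsum y hy, one_mul]
    _ ≤ ∑ i, (1 + K (c i)) ^ (d - 1) * ∫ y in Ω, ‖gradient (fun z => η i z * F z) y‖ :=
        Finset.sum_le_sum fun i _ => (h _ (hc i)).integral_surface_le_integral_norm_gradient
          hΩ.isOpen (hFη i) fun y => mul_nonneg (hη0 i y) (hF0 y)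
    _ ≤ ∑ i, (1 + K (c i)) ^ (d - 1) * (M i * ∫ y in Ω, (F y + ‖gradient F y‖)) := by
        gcongr with i
        rw [← integral_const_mul]
        exact integral_mono ((hFη i).mono (subset_univ _)).integrable_gradient.norm
          (hint.const_mul _) (hgrad i)
    _ = (∑ i, (1 + K (c i)) ^ (d - 1) * M i) * ∫ y in Ω, (F y + ‖gradient F y‖) := by
        simp only [Finset.sum_mul, mul_assoc]

end BoundaryEstimates

section SobolevSpace

variable {d : ℕ} {Ω : Set (E d)} {φ ψ : E d → ℝ}

section Lp

variable {X V : Type*} [MeasurableSpace X] {μ : Measure X} [NormedAddCommGroup V]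
  [InnerProductSpace ℝ V]

theorem inner_toLp (f : Lp V 2 μ) {g : X → V} (hg : MemLp g 2 μ) :
    inner ℝ f (hg.toLp g) = ∫ x, inner ℝ (f x) (g x) ∂μ := by
  rw [L2.inner_def]
  exact integral_congr_ae (hg.coeFn_toLp.mono fun x hx => by simp only [hx])

theorem norm_sq_eq_integral (f : Lp V 2 μ) {g : X → V} (h : f =ᵐ[μ] g) :
    ‖f‖ ^ 2 = ∫ x, ‖g x‖ ^ 2 ∂μ := by
  rw [← real_inner_self_eq_norm_sq, L2.inner_def]
  exact integral_congr_ae (h.mono fun x hx => by simp only [real_inner_self_eq_norm_sq, hx])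

theorem continuous_integral_bilinear {F G Z : Type*} [NormedAddCommGroup F] [NormedSpace ℝ F]
    [NormedAddCommGroup G] [NormedSpace ℝ G] [NormedAddCommGroup Z] [NormedSpace ℝ Z]
    [CompleteSpace Z] (B : F →L[ℝ] G →L[ℝ] Z) {g : X → G} (hg : MemLp g 2 μ) :
    Continuous fun u : Lp F 2 μ => ∫ x, B (u x) (g x) ∂μ := by
  have hpairing (u : Lp F 2 μ) : ∫ x, B (u x) (g x) ∂μ = B.lpPairing μ 2 2 u (hg.toLp g) := by
    rw [lpPairing_eq_integral]
    exact integral_congr_ae (hg.coeFn_toLp.mono fun x hx => by simp only [hx])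
  simp only [hpairing]
  fun_prop

end Lp

section ZeroExtension

variable {V : Type*} [NormedAddCommGroup V]

theorem memLp_indicator (hΩ : IsOpen Ω) (u : Lp V 2 (volume.restrict Ω)) :
    MemLp (Ω.indicator u) 2 volume :=
  (memLp_indicator_iff_restrict hΩ.measurableSet).2 (Lp.memLp u)

theorem integral_bilinear_indicator {F G Z : Type*} [NormedAddCommGroup F] [NormedSpace ℝ F]
    [NormedAddCommGroup G] [NormedSpace ℝ G] [NormedAddCommGroup Z] [NormedSpace ℝ Z]
    (hΩ : IsOpen Ω) (B : F →L[ℝ] G →L[ℝ] Z) (u : E d → F) (g : E d → G) :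
    ∫ x, B (Ω.indicator u x) (g x) = ∫ x in Ω, B (u x) (g x) := by
  rw [← integral_indicator hΩ.measurableSet]
  congr 1 with x
  by_cases hx : x ∈ Ω <;> simp [hx]

theorem integral_inner_indicator [InnerProductSpace ℝ V] (hΩ : IsOpen Ω)
    (u v : Lp V 2 (volume.restrict Ω)) :
    ∫ x, inner ℝ (Ω.indicator u x) (Ω.indicator v x) = inner ℝ u v := by
  rw [L2.inner_def, ← integral_indicator hΩ.measurableSet]
  congr 1 with x
  by_cases hx : x ∈ Ω <;> simp [hx]

theorem integral_mul_indicator (hΩ : IsOpen Ω) (u v : L2 Ω) :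
    ∫ x, Ω.indicator u x * Ω.indicator v x = inner ℝ u v := by
  rw [← integral_inner_indicator hΩ]
  exact integral_congr_ae (.of_forall fun x => mul_comm _ _)

theorem isWeakGradientOn_indicator_iff {O : Set (E d)} (hΩ : IsOpen Ω) {u : E d → ℝ}
    {G : E d → E d} : IsWeakGradientOn O (Ω.indicator u) (Ω.indicator G) ↔
      ∀ φ, IsTest O φ → ∫ x in Ω, u x • gradient φ x = -∫ x in Ω, φ x • G x :=
  forall₂_congr fun φ _ => by
    have hu : ∫ x, Ω.indicator u x • gradient φ x = ∫ x in Ω, u x • gradient φ x :=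
      integral_bilinear_indicator hΩ (lsmul ℝ ℝ) u (gradient φ)
    have hG : ∫ x, φ x • Ω.indicator G x = ∫ x in Ω, φ x • G x :=
      integral_bilinear_indicator hΩ (lsmul ℝ ℝ).flip G φ
    rw [hu, hG]

theorem isWeakDivergenceOn_indicator_iff {O : Set (E d)} (hΩ : IsOpen Ω) {σ : E d → E d}
    {f : E d → ℝ} : IsWeakDivergenceOn O (Ω.indicator σ) (Ω.indicator f) ↔
      ∀ φ, IsTest O φ → ∫ x in Ω, inner ℝ (σ x) (gradient φ x) = -∫ x in Ω, f x * φ x :=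
  forall₂_congr fun φ _ => by
    have hσ : ∫ x, inner ℝ (Ω.indicator σ x) (gradient φ x) =
        ∫ x in Ω, inner ℝ (σ x) (gradient φ x) :=
      integral_bilinear_indicator hΩ (innerSL ℝ) σ (gradient φ)
    have hf : ∫ x, Ω.indicator f x * φ x = ∫ x in Ω, f x * φ x :=
      integral_bilinear_indicator hΩ (ContinuousLinearMap.mul ℝ ℝ) f φ
    rw [hσ, hf]

theorem isWeakGradientOn_indicator (hΩ : IsOpen Ω) (w : H1 Ω) :
    IsWeakGradientOn Ω (Ω.indicator (fn w)) (Ω.indicator (grad w)) :=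
  (isWeakGradientOn_indicator_iff hΩ).2 w.2

theorem HasWeakDiv.isWeakDivergenceOn_indicator (hΩ : IsOpen Ω) {σ : L2v Ω} {f : L2 Ω}
    (h : HasWeakDiv Ω σ f) : IsWeakDivergenceOn Ω (Ω.indicator σ) (Ω.indicator f) :=
  (isWeakDivergenceOn_indicator_iff hΩ).2 h

theorem inner_grad_add_inner_eq_zero_of_isWeakDivergenceOn (hΩ : IsBoundedLipschitzDomain Ω)
    (w : H1 Ω) {σ : L2v Ω} {f : L2 Ω}
    (hσ : IsWeakDivergenceOn univ (Ω.indicator σ) (Ω.indicator f)) :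
    inner ℝ (grad w) σ + inner ℝ (fn w) f = 0 := by
  have hO := hΩ.isOpen
  rw [← integral_inner_indicator hO, ← integral_mul_indicator hO]
  exact (isWeakGradientOn_indicator hO w).green_of_field_eq_zero hσ hO
    hΩ.isBounded hΩ.hasInwardTranslations (memLp_indicator hO _) (memLp_indicator hO _)
    (memLp_indicator hO _) (memLp_indicator hO _) (fun x hx => indicator_of_notMem hx _)
    fun x hx => indicator_of_notMem hx _

theorem HasWeakDiv.inner_grad_add_inner_eq_zero (hΩ : IsBoundedLipschitzDomain Ω) {w : H1 Ω}
    {σ : L2v Ω} {f : L2 Ω} (hσ : HasWeakDiv Ω σ f)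
    (hw : IsWeakGradientOn univ (Ω.indicator (fn w)) (Ω.indicator (grad w))) :
    inner ℝ (grad w) σ + inner ℝ (fn w) f = 0 := by
  have hO := hΩ.isOpen
  rw [← integral_inner_indicator hO, ← integral_mul_indicator hO]
  exact hw.green_of_function_eq_zero
    (hσ.isWeakDivergenceOn_indicator hO) hO hΩ.isBounded
    hΩ.hasInwardTranslations (memLp_indicator hO _) (memLp_indicator hO _) (memLp_indicator hO _)
    (memLp_indicator hO _) (fun x hx => indicator_of_notMem hx _)
    fun x hx => indicator_of_notMem hx _

end ZeroExtension

theorem isClosed_H1 : IsClosed (H1 Ω : Set (WithLp 2 (L2 Ω × L2v Ω))) := by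
  have hinter : (H1 Ω : Set (WithLp 2 (L2 Ω × L2v Ω))) = ⋂ (φ : E d → ℝ) (_ : IsTest Ω φ),
      {w | ∫ x in Ω, w.fst x • gradient φ x = -∫ x in Ω, φ x • w.snd x} := by
    ext w
    simp only [mem_iInter]
    rfl
  rw [hinter]
  refine isClosed_iInter fun φ => isClosed_iInter fun hφ => isClosed_eq ?_ ?_
  · exact (continuous_integral_bilinear (lsmul ℝ ℝ) hφ.memLp_gradient).comp
      (WithLp.continuous_fst 2 _ _)
  · exact ((continuous_integral_bilinear (lsmul ℝ ℝ).flip hφ.memLp).comp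
      (WithLp.continuous_snd 2 _ _)).neg

instance : CompleteSpace (H1 Ω) := isClosed_H1.completeSpace_coe

theorem inner_H1 (w z : H1 Ω) : inner ℝ w z = inner ℝ (fn w) (fn z) + inner ℝ (grad w) (grad z) :=
  rfl

theorem norm_sq_H1 (w : H1 Ω) : ‖w‖ ^ 2 = ‖fn w‖ ^ 2 + ‖grad w‖ ^ 2 := by
  simp only [← real_inner_self_eq_norm_sq, inner_H1]

theorem IsTest.setIntegral_smul_gradient (hψ : IsTest Ω ψ) (hφ : ContDiff ℝ ∞ φ) :
    ∫ x in Ω, φ x • gradient ψ x = -∫ x in Ω, ψ x • gradient φ x := by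
  have hgrad : Continuous (gradient φ) := continuous_gradient (hφ.of_le (by simp))
  have hgradψ : Continuous (gradient ψ) := continuous_gradient (hψ.contDiff.of_le (by simp))
  have hψφ : Integrable (fun x => ψ x • gradient φ x) (volume.restrict Ω) :=
    (hψ.contDiff.continuous.smul hgrad).integrable_of_hasCompactSupport
      hψ.hasCompactSupport.smul_right
  have hφψ : Integrable (fun x => φ x • gradient ψ x) (volume.restrict Ω) :=
    (hφ.continuous.smul hgradψ).integrable_of_hasCompactSupport
      (hasCompactSupport_gradient hψ.hasCompactSupport).smul_left
  rw [eq_neg_iff_add_eq_zero, add_comm, ← integral_add hψφ hφψ,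
    ← (hψ.mul hφ).setIntegral_gradient_eq_zero]
  congr 1 with x : 1
  exact (gradient_fun_mul (hψ.differentiableAt x) (hφ.differentiable (by simp) x)).symm

theorem IsTest.exists_H1 (hφ : IsTest univ φ) : ∃ w : H1 Ω,
    fn w =ᵐ[volume.restrict Ω] φ ∧ grad w =ᵐ[volume.restrict Ω] gradient φ := by
  have hfn : MemLp φ 2 (volume.restrict Ω) :=
    hφ.contDiff.continuous.memLp_of_hasCompactSupport hφ.hasCompactSupport
  have hgrad : MemLp (gradient φ) 2 (volume.restrict Ω) :=
    (continuous_gradient (hφ.contDiff.of_le (by simp))).memLp_of_hasCompactSupport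
      (hasCompactSupport_gradient hφ.hasCompactSupport)
  refine ⟨⟨WithLp.toLp 2 (hfn.toLp φ, hgrad.toLp (gradient φ)), fun ψ hψ => ?_⟩,
    hfn.coeFn_toLp, hgrad.coeFn_toLp⟩
  calc ∫ x in Ω, hfn.toLp φ x • gradient ψ x
      = ∫ x in Ω, φ x • gradient ψ x :=
        integral_congr_ae (hfn.coeFn_toLp.mono fun x hx => congrArg (· • gradient ψ x) hx)
    _ = -∫ x in Ω, ψ x • gradient φ x := hψ.setIntegral_smul_gradient hφ.contDiff
    _ = -∫ x in Ω, ψ x • hgrad.toLp (gradient φ) x := congrArg Neg.neg <|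
        integral_congr_ae (hgrad.coeFn_toLp.mono fun x hx => congrArg (ψ x • ·) hx.symm)

theorem grad_ae_eq_gradient (hΩ : IsOpen Ω) {w : H1 Ω} (hφ : ContDiff ℝ ∞ φ)
    (h : fn w =ᵐ[volume.restrict Ω] φ) : grad w =ᵐ[volume.restrict Ω] gradient φ := by
  have hgrad : Continuous (gradient φ) := continuous_gradient (hφ.of_le (by simp))
  have hloc : LocallyIntegrableOn (fun x => grad w x - gradient φ x) Ω :=
    (locallyIntegrableOn_of_locallyIntegrable_restrict
      ((Lp.memLp (grad w)).locallyIntegrable (by norm_num))).sub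
      (hgrad.locallyIntegrable.locallyIntegrableOn _)
  have hae := hΩ.ae_eq_zero_of_integral_contDiff_smul_eq_zero hloc fun ψ hψ hψc hψs => ?_
  · filter_upwards [(ae_restrict_iff' hΩ.measurableSet).2 hae] with x hx
    exact sub_eq_zero.1 hx
  have hT : IsTest Ω ψ := ⟨hψ, hψc, hψs⟩
  have hparts : ∫ x in Ω, ψ x • grad w x = ∫ x in Ω, ψ x • gradient φ x := by
    rw [← neg_inj, ← hT.setIntegral_smul_gradient hφ]
    exact (w.2 ψ hT).symm.trans
      (integral_congr_ae (h.mono fun x hx => by simp only [← hx]; rfl))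
  rw [← setIntegral_eq_integral_of_forall_compl_eq_zero (s := Ω) fun x hx => by
    rw [image_eq_zero_of_notMem_tsupport fun hx' => hx (hψs hx'), zero_smul]]
  have hwint : Integrable (fun x => ψ x • grad w x) (volume.restrict Ω) :=
    integrable_smul_of_memLp hT.memLp (Lp.memLp _)
  have hφint : Integrable (fun x => ψ x • gradient φ x) (volume.restrict Ω) :=
    (hψ.continuous.smul hgrad).integrable_of_hasCompactSupport hψc.smul_right
  simp only [smul_sub]
  rw [integral_sub hwint hφint, hparts, sub_self]

theorem topologicalClosure_map_fst_smoothTraceGraph (hΩ : IsBoundedLipschitzDomain Ω) :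
    ((smoothTraceGraph Ω).map (LinearMap.fst ℝ (H1 Ω) (L2Γ Ω))).topologicalClosure = ⊤ := by
  have := hΩ.isFiniteMeasure_surface
  rw [Submodule.topologicalClosure_eq_top_iff, Submodule.eq_bot_iff]
  intro w hw
  suffices hdiv : IsWeakDivergenceOn univ (Ω.indicator (grad w)) (Ω.indicator (fn w)) by
    have hinner := inner_grad_add_inner_eq_zero_of_isWeakDivergenceOn hΩ w hdiv
    rwa [add_comm, ← inner_H1, inner_self_eq_zero] at hinner
  refine (isWeakDivergenceOn_indicator_iff hΩ.isOpen).2 fun φ hφ => ?_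
  obtain ⟨z, hz, hgradz⟩ := hφ.exists_H1 (Ω := Ω)
  have hφΓ : MemLp φ 2 (surface Ω) :=
    hφ.contDiff.continuous.memLp_of_hasCompactSupport hφ.hasCompactSupport
  have hzw : inner ℝ z w = 0 := hw z ⟨(z, hφΓ.toLp φ), ⟨φ, hφ.contDiff, hz, hφΓ.coeFn_toLp⟩, rfl⟩
  rw [real_inner_comm, inner_H1, L2.inner_def, L2.inner_def, add_comm] at hzw
  rw [eq_neg_iff_add_eq_zero, ← hzw]
  congr 1
  · exact integral_congr_ae (hgradz.mono fun x hx => by simp only [hx])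
  · exact integral_congr_ae (hz.mono fun x hx =>
      (mul_comm _ _).trans (congrArg (inner ℝ (fn w x)) hx.symm))

end SobolevSpace

section TraceOperator

variable {d : ℕ} {Ω : Set (E d)}

theorem isClosed_map_fst {X Y : Type*} [NormedAddCommGroup X] [NormedSpace ℝ X] [CompleteSpace X]
    [NormedAddCommGroup Y] [NormedSpace ℝ Y] [CompleteSpace Y] {S : Submodule ℝ (X × Y)}
    (hS : IsClosed (S : Set (X × Y))) {C : ℝ} (hC : ∀ p ∈ S, ‖p.2‖ ≤ C * ‖p.1‖) :
    IsClosed (S.map (LinearMap.fst ℝ X Y) : Set X) := by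
  have : CompleteSpace S := hS.completeSpace_coe
  let P : S →L[ℝ] X := (ContinuousLinearMap.fst ℝ X Y).comp S.subtypeL
  have hanti : AntilipschitzWith (max 1 C).toNNReal P := by
    refine P.antilipschitz_of_bound fun p => ?_
    rw [Real.coe_toNNReal _ (by positivity)]
    exact max_le (le_mul_of_one_le_left (norm_nonneg _) (le_max_left _ _))
      ((hC p p.2).trans (mul_le_mul_of_nonneg_right (le_max_right _ _) (norm_nonneg _)))
  convert hanti.isClosed_range P.uniformContinuous
  ext x
  simp [P]

theorem norm_gradient_mul_self_le {φ : E d → ℝ} {x : E d} (hφ : DifferentiableAt ℝ φ x) :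
    ‖gradient (fun y => φ y * φ y) x‖ ≤ φ x * φ x + ‖gradient φ x‖ ^ 2 := by
  rw [gradient_fun_mul hφ hφ, ← two_smul ℝ, norm_smul, norm_smul, Real.norm_ofNat, ← mul_assoc]
  simpa only [Real.norm_eq_abs, sq, abs_mul_abs_self] using
    two_mul_le_add_sq ‖φ x‖ ‖gradient φ x‖

theorem exists_norm_le_of_mem_traceGraph (hΩ : IsBoundedLipschitzDomain Ω) :
    ∃ C : ℝ, ∀ p ∈ traceGraph Ω, ‖p.2‖ ≤ C * ‖p.1‖ := by
  obtain ⟨C, hC0, hC⟩ := hΩ.exists_integral_surface_le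
  have hclosed : IsClosed {p : H1 Ω × L2Γ Ω | ‖p.2‖ ≤ √(C * 2) * ‖p.1‖} :=
    isClosed_le (by fun_prop) (by fun_prop)
  refine ⟨√(C * 2), fun p hp => closure_minimal (fun p hp => ?_) hclosed hp⟩
  obtain ⟨φ, hφ, hfn, htr⟩ := hp
  have hgrad := grad_ae_eq_gradient hΩ.isOpen hφ hfn
  have hgc : Continuous (gradient φ) := continuous_gradient (hφ.of_le (by simp))
  have hsq : ContDiff ℝ ∞ fun y => φ y * φ y := hφ.mul hφ
  have hnorm : ‖p.2‖ ^ 2 ≤ C * 2 * ‖p.1‖ ^ 2 := by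
    calc ‖p.2‖ ^ 2 = ∫ y, φ y * φ y ∂(surface Ω) := by
          simp only [norm_sq_eq_integral _ htr, Real.norm_eq_abs, sq, abs_mul_abs_self]
      _ ≤ C * ∫ y in Ω, (φ y * φ y + ‖gradient (fun y => φ y * φ y) y‖) :=
          hC _ hsq fun y => mul_self_nonneg _
      _ ≤ C * ∫ y in Ω, 2 * (φ y * φ y + ‖gradient φ y‖ ^ 2) := by
          refine mul_le_mul_of_nonneg_left (integral_mono (hΩ.integrableOn (hsq.continuous.add
            (continuous_gradient (hsq.of_le (by simp))).norm)) (hΩ.integrableOn (by fun_prop))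
            fun y => ?_) hC0
          linarith [norm_gradient_mul_self_le (hφ.differentiable (by simp) y),
            sq_nonneg ‖gradient φ y‖]
      _ = C * 2 * ‖p.1‖ ^ 2 := by
          have hφint : IntegrableOn (fun y => φ y * φ y) Ω := hΩ.integrableOn hsq.continuous
          have hgint : IntegrableOn (fun y => ‖gradient φ y‖ ^ 2) Ω :=
            hΩ.integrableOn (by fun_prop)
          rw [integral_const_mul, integral_add hφint hgint, norm_sq_H1,
            norm_sq_eq_integral _ hfn, norm_sq_eq_integral _ hgrad, mul_assoc]
          simp only [Real.norm_eq_abs, sq, abs_mul_abs_self]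
  calc ‖p.2‖ ≤ √(C * 2 * ‖p.1‖ ^ 2) := Real.le_sqrt_of_sq_le hnorm
    _ = √(C * 2) * ‖p.1‖ := by rw [Real.sqrt_mul (by positivity), Real.sqrt_sq (norm_nonneg _)]

theorem exists_isTrace (hΩ : IsBoundedLipschitzDomain Ω) (w : H1 Ω) : ∃ f, IsTrace w f := by
  obtain ⟨C, hC⟩ := exists_norm_le_of_mem_traceGraph hΩ
  have hle : (⊤ : Submodule ℝ (H1 Ω)) ≤ (traceGraph Ω).map (LinearMap.fst ℝ (H1 Ω) (L2Γ Ω)) := by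
    rw [← topologicalClosure_map_fst_smoothTraceGraph hΩ]
    exact Submodule.topologicalClosure_minimal _
      (Submodule.map_mono (Submodule.le_topologicalClosure _))
      (isClosed_map_fst (Submodule.isClosed_topologicalClosure _) hC)
  obtain ⟨⟨_, f⟩, hf, rfl⟩ := hle (Submodule.mem_top (x := w))
  exact ⟨f, hf⟩

theorem IsTrace.unique (hΩ : IsBoundedLipschitzDomain Ω) {w : H1 Ω} {f g : L2Γ Ω}
    (hf : IsTrace w f) (hg : IsTrace w g) : f = g := by
  obtain ⟨C, hC⟩ := exists_norm_le_of_mem_traceGraph hΩ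
  have hle := hC _ ((traceGraph Ω).sub_mem hf hg)
  rw [Prod.mk_sub_mk, sub_self, norm_zero, mul_zero] at hle
  exact sub_eq_zero.1 (norm_le_zero_iff.1 hle)

theorem isTrace_trace (hΩ : IsBoundedLipschitzDomain Ω) (w : H1 Ω) :
    IsTrace w (trace w : L2Γ Ω) := by
  obtain ⟨f, hf⟩ := exists_isTrace hΩ w
  exact Classical.epsilon_spec (p := fun f : Hhalf Ω => IsTrace w (f : L2Γ Ω))
    ⟨⟨f, (w, f), hf, rfl⟩, hf⟩

theorem IsTrace.trace_eq (hΩ : IsBoundedLipschitzDomain Ω) {w : H1 Ω} {f : Hhalf Ω}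
    (h : IsTrace w (f : L2Γ Ω)) : trace w = f :=
  Subtype.ext ((isTrace_trace hΩ w).unique hΩ h)

/-- The trace operator `w ↦ w|_Γ` as a linear map from `H¹(Ω)` onto `H^{1/2}(Γ)`. -/
def traceLinearMap (hΩ : IsBoundedLipschitzDomain Ω) : H1 Ω →ₗ[ℝ] Hhalf Ω where
  toFun := trace
  map_add' w z :=
    IsTrace.trace_eq hΩ ((traceGraph Ω).add_mem (isTrace_trace hΩ w) (isTrace_trace hΩ z))
  map_smul' c w := IsTrace.trace_eq hΩ ((traceGraph Ω).smul_mem c (isTrace_trace hΩ w))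

theorem trace_sub (hΩ : IsBoundedLipschitzDomain Ω) (w z : H1 Ω) :
    trace (w - z) = trace w - trace z :=
  map_sub (traceLinearMap hΩ) w z

theorem isTrace_zero_of_trace_eq_zero (hΩ : IsBoundedLipschitzDomain Ω) {w : H1 Ω}
    (h : trace w = 0) : IsTrace w 0 := by
  simpa only [h, ZeroMemClass.coe_zero] using isTrace_trace hΩ w

end TraceOperator

section ZeroTrace

variable {d : ℕ} {Ω : Set (E d)}

theorem integral_abs_mul_le {X : Type*} [MeasurableSpace X] {μ : Measure X} (f : Lp ℝ 2 μ)
    {φ ψ : X → ℝ} (hf : f =ᵐ[μ] φ) (hψ : MemLp ψ 2 μ) :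
    ∫ x, |φ x * ψ x| ∂μ ≤ ‖hψ.toLp ψ‖ * ‖f‖ := by
  have hinner : ∫ x, |φ x * ψ x| ∂μ = inner ℝ |hψ.toLp ψ| |f| := by
    rw [L2.inner_def]
    refine integral_congr_ae ?_
    filter_upwards [hf, hψ.coeFn_toLp, Lp.coeFn_abs (hψ.toLp ψ), Lp.coeFn_abs f]
      with x hfx hψx habsψ habsf
    rw [habsψ, habsf, hfx, hψx, abs_mul]
    rfl
  rw [hinner, ← norm_abs_eq_norm (hψ.toLp ψ), ← norm_abs_eq_norm f]
  exact real_inner_le_norm _ _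

theorem exists_norm_green_le_of_mem_traceGraph (hΩ : IsBoundedLipschitzDomain Ω) {ψ : E d → ℝ}
    (hψ : IsTest univ ψ) : ∃ C : ℝ, ∀ p ∈ traceGraph Ω,
      ‖(∫ x in Ω, fn p.1 x • gradient ψ x) + ∫ x in Ω, ψ x • grad p.1 x‖ ≤ C * ‖p.2‖ := by
  have := hΩ.isFiniteMeasure_surface
  obtain ⟨C, hC0, hC⟩ := hΩ.exists_norm_setIntegral_gradient_le
  have hψΩ : MemLp ψ 2 (volume.restrict Ω) :=
    hψ.contDiff.continuous.memLp_of_hasCompactSupport hψ.hasCompactSupport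
  have hψΓ : MemLp ψ 2 (surface Ω) :=
    hψ.contDiff.continuous.memLp_of_hasCompactSupport hψ.hasCompactSupport
  have hgψ : MemLp (gradient ψ) 2 (volume.restrict Ω) :=
    (continuous_gradient (hψ.contDiff.of_le (by simp))).memLp_of_hasCompactSupport
      (hasCompactSupport_gradient hψ.hasCompactSupport)
  have hclosed : IsClosed {p : H1 Ω × L2Γ Ω |
      ‖(∫ x in Ω, fn p.1 x • gradient ψ x) + ∫ x in Ω, ψ x • grad p.1 x‖ ≤
        C * ‖hψΓ.toLp ψ‖ * ‖p.2‖} := by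
    refine isClosed_le (Continuous.norm (Continuous.add ?_ ?_)) (by fun_prop)
    · exact (continuous_integral_bilinear (lsmul ℝ ℝ) hgψ).comp
        ((WithLp.continuous_fst 2 _ _).comp (continuous_subtype_val.comp continuous_fst))
    · exact (continuous_integral_bilinear (lsmul ℝ ℝ).flip hψΩ).comp
        ((WithLp.continuous_snd 2 _ _).comp (continuous_subtype_val.comp continuous_fst))
  refine ⟨C * ‖hψΓ.toLp ψ‖, fun p hp => closure_minimal (fun p hp => ?_) hclosed hp⟩
  obtain ⟨φ, hφ, hfn, htr⟩ := hp
  have hsum : (∫ x in Ω, fn p.1 x • gradient ψ x) + ∫ x in Ω, ψ x • grad p.1 x =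
      ∫ x in Ω, gradient (fun x => φ x * ψ x) x := by
    rw [← integral_add (integrable_smul_of_memLp (Lp.memLp _) hgψ)
      (integrable_smul_of_memLp hψΩ (Lp.memLp _))]
    refine integral_congr_ae ?_
    filter_upwards [hfn, grad_ae_eq_gradient hΩ.isOpen hφ hfn] with x hfnx hgradx
    rw [gradient_fun_mul (hφ.differentiable (by simp) x) (hψ.differentiableAt x), hfnx, hgradx]
  calc ‖(∫ x in Ω, fn p.1 x • gradient ψ x) + ∫ x in Ω, ψ x • grad p.1 x‖
      ≤ C * ∫ y, |φ y * ψ y| ∂(surface Ω) := hsum ▸ hC _ (hφ.mul hψ.contDiff)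
    _ ≤ C * (‖hψΓ.toLp ψ‖ * ‖p.2‖) :=
        mul_le_mul_of_nonneg_left (integral_abs_mul_le p.2 htr hψΓ) hC0
    _ = C * ‖hψΓ.toLp ψ‖ * ‖p.2‖ := (mul_assoc _ _ _).symm

theorem IsTrace.isWeakGradientOn_univ_indicator (hΩ : IsBoundedLipschitzDomain Ω) {w : H1 Ω}
    (hw : IsTrace w 0) : IsWeakGradientOn univ (Ω.indicator (fn w)) (Ω.indicator (grad w)) := by
  refine (isWeakGradientOn_indicator_iff hΩ.isOpen).2 fun ψ hψ => ?_
  obtain ⟨C, hC⟩ := exists_norm_green_le_of_mem_traceGraph hΩ hψ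
  have hle := hC _ hw
  rw [norm_zero, mul_zero, norm_le_zero_iff] at hle
  exact eq_neg_of_add_eq_zero_left hle

theorem IsTrace.inner_grad_add_inner_eq_zero (hΩ : IsBoundedLipschitzDomain Ω) {w : H1 Ω}
    (hw : IsTrace w 0) {σ : L2v Ω} {f : L2 Ω} (hσ : HasWeakDiv Ω σ f) :
    inner ℝ (grad w) σ + inner ℝ (fn w) f = 0 :=
  hσ.inner_grad_add_inner_eq_zero hΩ (hw.isWeakGradientOn_univ_indicator hΩ)

theorem IsTrace.eq_zero_of_grad_eq_zero (hd : 0 < d) (hΩ : IsBoundedLipschitzDomain Ω) {w : H1 Ω}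
    (hw : IsTrace w 0) (hgrad : grad w = 0) : w = 0 := by
  have hO := hΩ.isOpen
  have hgrad_ext : Ω.indicator (grad w) =ᵐ[volume] 0 :=
    indicator_ae_eq_zero_of_restrict_ae_eq_zero hO.measurableSet
      ((Lp.eq_zero_iff_ae_eq_zero).1 hgrad)
  have hext : IsWeakGradientOn univ (Ω.indicator (fn w)) 0 := fun φ hφ =>
    (hw.isWeakGradientOn_univ_indicator hΩ φ hφ).trans <| congrArg Neg.neg <|
      integral_congr_ae (hgrad_ext.mono fun x hx => congrArg (φ x • ·) hx)
  have hfn_ext : Ω.indicator (fn w) =ᵐ[volume] 0 :=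
    hext.ae_eq_zero_of_hasCompactSupport hd ((memLp_indicator hO _).locallyIntegrable (by norm_num))
      (.intro hΩ.isBounded.isCompact_closure fun x hx =>
        indicator_of_notMem (fun h => hx (subset_closure h)) _)
  have hfn : fn w = 0 := (Lp.eq_zero_iff_ae_eq_zero).2
    ((indicator_ae_eq_restrict hO.measurableSet).symm.trans (ae_restrict_of_ae hfn_ext))
  rw [← norm_eq_zero, ← sq_eq_zero_iff, norm_sq_H1, hfn, hgrad]
  simp

end ZeroTrace

section NormalTrace

variable {d : ℕ} {Ω : Set (E d)}

/-- The right-hand side `w ↦ (∇w, σ)_{L²(Ω)} + (w, div σ)_{L²(Ω)}` of Green's formula, which for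
`σ ∈ H(div, Ω)` factors through the trace operator and so defines the normal trace of `σ`.  It is
the inner product of `(w, ∇w)` with `(div σ, σ)`. -/
def greenFunctional (σ : Hdiv Ω) : H1 Ω →ₗ[ℝ] ℝ :=
  innerₛₗ ℝ (WithLp.toLp 2 (σ.div, σ.field)) ∘ₗ (H1 Ω).subtype

theorem greenFunctional_apply (σ : Hdiv Ω) (w : H1 Ω) :
    greenFunctional σ w = inner ℝ (grad w) σ.field + inner ℝ (fn w) σ.div := by
  rw [real_inner_comm (σ.field) (grad w), real_inner_comm (σ.div) (fn w), add_comm]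
  rfl

theorem dualPairing_normalTrace (hΩ : IsBoundedLipschitzDomain Ω) (σ : Hdiv Ω) (w : H1 Ω) :
    dualPairing (trace w) (normalTrace σ) =
      inner ℝ (grad w) σ.field + inner ℝ (fn w) σ.div := by
  have hmem : greenFunctional σ ∈ (LinearMap.ker (traceLinearMap hΩ)).dualAnnihilator := by
    refine (Submodule.mem_dualAnnihilator _).2 fun w hw => ?_
    rw [greenFunctional_apply]
    exact (isTrace_zero_of_trace_eq_zero hΩ hw).inner_grad_add_inner_eq_zero hΩ σ.hasWeakDiv
  rw [← LinearMap.range_dualMap_eq_dualAnnihilator_ker] at hmem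
  obtain ⟨ℓ, hℓ⟩ := hmem
  have hℓ_trace (w : H1 Ω) (f : Hhalf Ω) (hf : IsTrace w (f : L2Γ Ω)) :
      ℓ f = greenFunctional σ w := by
    rw [← hf.trace_eq hΩ, ← hℓ]
    rfl
  have hbound : ℓ ∈ HmHalf Ω := ⟨‖WithLp.toLp 2 (σ.div, σ.field)‖, fun w f hf => by
    rw [hℓ_trace w f hf]
    exact abs_real_inner_le_norm (WithLp.toLp 2 (σ.div, σ.field)) w.1⟩
  exact Classical.epsilon_spec (p := fun ℓ : HmHalf Ω => ∀ (w : H1 Ω) (f : Hhalf Ω),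
      IsTrace w (f : L2Γ Ω) → dualPairing f ℓ = inner ℝ (grad w) σ.field + inner ℝ (fn w) σ.div)
    ⟨⟨ℓ, hbound⟩, fun w f hf => (hℓ_trace w f hf).trans (greenFunctional_apply σ w)⟩
    w _ (isTrace_trace hΩ w)

end NormalTrace

section Extremal

variable {d : ℕ} {Ω : Set (E d)}

theorem hasWeakDiv_iff {σ : L2v Ω} {f : L2 Ω} :
    HasWeakDiv Ω σ f ↔ ∀ φ (hφ : IsTest Ω φ),
      inner ℝ σ (hφ.memLp_gradient.toLp (gradient φ)) + inner ℝ f (hφ.memLp.toLp φ) = 0 :=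
  forall₂_congr fun φ hφ => by
    have hf : inner ℝ f (hφ.memLp.toLp φ) = ∫ x in Ω, f x * φ x :=
      (inner_toLp _ _).trans (integral_congr_ae (.of_forall fun x => mul_comm _ _))
    rw [inner_toLp, hf, eq_neg_iff_add_eq_zero]

theorem HasWeakDiv.sub {σ τ : L2v Ω} {f g : L2 Ω} (hσ : HasWeakDiv Ω σ f)
    (hτ : HasWeakDiv Ω τ g) : HasWeakDiv Ω (σ - τ) (f - g) :=
  hasWeakDiv_iff.2 fun φ hφ => by
    rw [inner_sub_left, inner_sub_left]
    linear_combination hasWeakDiv_iff.1 hσ φ hφ - hasWeakDiv_iff.1 hτ φ hφ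

theorem IsHarmonic.sub {u v : H1 Ω} (hu : IsHarmonic u) (hv : IsHarmonic v) :
    IsHarmonic (u - v) := by
  simpa only [sub_zero] using! HasWeakDiv.sub hu hv

theorem minorant_eq (hΩ : IsBoundedLipschitzDomain Ω) {τ : Hdiv Ω} (hτ : τ.div = 0) {γ g : Hhalf Ω}
    {w : H1 Ω} (hw : trace w = g - γ) :
    minorant τ γ g = ‖grad w‖ ^ 2 - ‖τ.field - grad w‖ ^ 2 := by
  rw [minorant, ← hw, dualPairing_normalTrace hΩ, hτ, inner_zero_right, add_zero,
    norm_sub_sq_real, real_inner_comm]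
  ring

theorem IsHarmonic.majorant_eq (hΩ : IsBoundedLipschitzDomain Ω) {z w : H1 Ω} (hz : IsHarmonic z)
    (hw : trace w = trace z) : majorant (grad w) = ‖grad z‖ ^ 2 + ‖grad w - grad z‖ ^ 2 := by
  have hwz : IsTrace (w - z) 0 :=
    isTrace_zero_of_trace_eq_zero hΩ (by rw [trace_sub hΩ, hw, sub_self])
  have horth : inner ℝ (grad z) (grad w - grad z) = 0 := by
    have hgreen := hwz.inner_grad_add_inner_eq_zero hΩ hz
    rwa [inner_zero_right, add_zero, real_inner_comm] at hgreen
  rw [majorant, ← add_sub_cancel (grad z) (grad w), norm_add_sq_real, horth, add_sub_cancel]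
  ring

theorem eq_of_trace_eq_of_grad_eq (hd : 0 < d) (hΩ : IsBoundedLipschitzDomain Ω) {w z : H1 Ω}
    (htrace : trace w = trace z) (hgrad : grad w = grad z) : w = z :=
  sub_eq_zero.1 <| (isTrace_zero_of_trace_eq_zero hΩ
    (by rw [trace_sub hΩ, htrace, sub_self])).eq_zero_of_grad_eq_zero hd hΩ (sub_eq_zero.2 hgrad)

end Extremal

end FunctionalError

end

open FunctionalError in
theorem theorem3p1_general {d : ℕ} (hd : 0 < d) (Ω : Set (E d)) (hΩ : IsBoundedLipschitzDomain Ω)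
    (g : Hhalf Ω) (u : H1 Ω) (hug : trace u = g) (v : H1 Ω) (huv : IsHarmonic (u - v)) :
    IsGreatest {m : ℝ | ∃ τ : Hdiv Ω, τ.div = 0 ∧ minorant τ (trace v) g = m}
      (‖grad (u - v)‖ ^ 2) ∧
    (∀ τ : Hdiv Ω, τ.div = 0 →
      (minorant τ (trace v) g = ‖grad (u - v)‖ ^ 2 ↔ τ.field = grad (u - v))) ∧
    IsLeast {m : ℝ | ∃ w : H1 Ω, trace w = g - trace v ∧ majorant (grad w) = m}
      (‖grad (u - v)‖ ^ 2) ∧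
    trace (u - v) = g - trace v ∧
    (∀ w : H1 Ω, trace w = g - trace v →
      (majorant (grad w) = ‖grad (u - v)‖ ^ 2 ↔ w = u - v)) := by
  have htrace : trace (u - v) = g - trace v := by rw [trace_sub hΩ, hug]
  have hmin (τ : Hdiv Ω) (hτ : τ.div = 0) := minorant_eq hΩ hτ htrace
  have hmaj (w : H1 Ω) (hw : trace w = g - trace v) :=
    huv.majorant_eq hΩ (hw.trans htrace.symm)
  refine ⟨⟨⟨⟨grad (u - v), 0, huv⟩, rfl, ?_⟩, ?_⟩, fun τ hτ => ?_,
    ⟨⟨u - v, htrace, rfl⟩, ?_⟩, htrace, fun w hw => ⟨fun h => ?_, fun h => h ▸ rfl⟩⟩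
  · rw [hmin _ rfl, sub_self, norm_zero, zero_pow two_ne_zero, sub_zero]
  · rintro _ ⟨τ, hτ, rfl⟩
    exact (hmin τ hτ).trans_le (sub_le_self _ (sq_nonneg _))
  · rw [hmin τ hτ, sub_eq_self, sq_eq_zero_iff, norm_eq_zero, sub_eq_zero]
  · rintro _ ⟨w, hw, rfl⟩
    exact (le_add_of_nonneg_right (sq_nonneg _)).trans_eq (hmaj w hw).symm
  · rw [hmaj w hw, add_eq_left, sq_eq_zero_iff, norm_eq_zero, sub_eq_zero] at h
    exact eq_of_trace_eq_of_grad_eq hd hΩ (hw.trans htrace.symm) h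

open FunctionalError in
theorem theorem3p1 {d : ℕ} (hd : 2 ≤ d) (Ω : Set (E d)) (hΩ : IsBoundedLipschitzDomain Ω)
    (g : Hhalf Ω) (u : H1 Ω) (hu : IsHarmonic u) (hug : trace u = g)
    (v : H1 Ω) (hv : IsHarmonic v) :
    -- maximum over solenoidal fields, with unique maximiser
    IsGreatest {m : ℝ | ∃ τ : Hdiv Ω, τ.div = 0 ∧ minorant τ (trace v) g = m}
      (‖grad (u - v)‖ ^ 2) ∧
    (∀ τ : Hdiv Ω, τ.div = 0 →
      (minorant τ (trace v) g = ‖grad (u - v)‖ ^ 2 ↔ τ.field = grad (u - v))) ∧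
    -- minimum over functions with the prescribed trace, with unique minimiser
    IsLeast {m : ℝ | ∃ w : H1 Ω, trace w = g - trace v ∧ majorant (grad w) = m}
      (‖grad (u - v)‖ ^ 2) ∧
    trace (u - v) = g - trace v ∧
    (∀ w : H1 Ω, trace w = g - trace v →
      (majorant (grad w) = ‖grad (u - v)‖ ^ 2 ↔ w = u - v)) :=
  theorem3p1_general (by omega) Ω hΩ g u hug v (hu.sub hv)
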